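/- **Theorem 7.6 (Local coordinate characterization of generalized principal connections).** All manifolds are real, finite-dimensional, smooth and Hausdorff. Let $G$ be a Lie group, $\dim G=l$, and let $\pi_{\mathcal G,M}\colon\mathcal G\to M$ be a Lie group fiber bundle with typical fiber $G$: the fibers $\mathcal G_x$ are groups (with unit $e_x$) and $\mathcal G$ has smooth local trivializations $\pi_{\mathcal G,M}^{-1}(U)\to U\times G$ that are group isomorphisms on the fibers. Let $\Phi\colon P\times_M\mathcal G\to P$ be a smooth, free and proper right fibered action on a smooth fiber bundle $\pi_{P,M}\colon P\to M$, let $\mathcal S=P/\mathcal G$ carry the smooth structure for which the quotient map $\pi_{P,\mathcal S}\colon P\to\mathcal S$ is a smooth fiber bundle with typical fiber $G$, and let $\pi_{\mathcal S,M}\colon\mathcal S\to M$ be the induced map. A connection on a fiber bundle $\pi\colon Z\to B$ is a smooth vector bundle morphism $T(Z)\to \ker T(\pi)$ over $\mathrm{id}_Z$ which is the identity on $\ker T(\pi)$; its horizontal lift at $z$ sends $a\in T_{\pi(z)}(B)$ to the horizontal part of any $v\in T_z(Z)$ with $T_z(\pi)(v)=a$. Let $\omega$ be a connection on $\pi_{P,\mathcal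 S}\colon P\to\mathcal S$, with horizontal lifts $\tau_p$, and $\nu$ a connection on $\pi_{\mathcal G,M}\colon \mathcal G\to M$, with horizontal lifts $\eta_\gamma$. One says that $\omega$ is a *generalized principal connection associated to* $\eta$ if $$\omega_{\Phi(p,\gamma)}\big(T_{(p,\gamma)}(\Phi)(z,v)\big)=T_p(\Phi_\gamma)\big(\omega_p(z)\big)+\Big(T_\gamma(L_{\gamma^{-1}})\big(\nu_\gamma(v)\big)\Big)^*_{\Phi(p,\gamma)}$$ for all $(p,\gamma)\in P\times_M\mathcal G$ over $x\in M$ and all $(z,v)\in T_p(P)\times_{T_x(M)}T_\gamma(\mathcal G)$, where $\Phi_\gamma=\Phi(\cdot,\gamma)$, $L_{\gamma^{-1}}$ is left translation by $\gamma^{-1}$ in $\mathcal G_x$, and $\xi^*_q=T_{e_x}(\Phi(q,\cdot))(\xi)$ for $q\in P_x$ and $\xi\in T_{e_x}(\mathcal G_x)$. *Generalized principal bundle coordinates* $(x^\mu,\sigma^\Theta,g^I)$ are given by: a local trivialization $\psi$ of $\mathcal G$ as above over an open $U\subseteq M$; coordinates $x^\mu$ on an open subset of $U$; fibered coordinates $(x^\mu,\sigma^\Theta)$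 on an open $V\subseteq\mathcal S$ (so $\pi_{\mathcal S,M}$ reads $(x,\sigma)\mapsto x$); a smooth section $s\colon V\to P$ of $\pi_{P,\mathcal S}$; and charts of $G$. The point of $P$ with coordinates $(x,\sigma)$ and group coordinate $g\in G$ is $\Phi\big(s(x,\sigma),\psi^{-1}(x,g)\big)$, and $(x,h)$ denotes the point $\psi^{-1}(x,h)$ of $\mathcal G$. In such coordinates the connection coefficients are defined by $$\tau_p(\partial_\mu)=\partial_\mu-A^I_\mu(x,\sigma,g)\,\partial_I,\qquad \tau_p(\partial_\Theta)=\partial_\Theta-A^I_\Theta(x,\sigma,g)\,\partial_I,\qquad \eta_\gamma(\partial_\mu)=\partial_\mu-\eta^I_\mu(x,h)\,\partial_I .$$ Let $\pi^I(g,h)$ be the local expression of the product of $G$ in charts of $G$ around $g$, $h$ and $gh$, and let $\partial^1_A\pi^I$, $\partial^2_A\pi^I$ be its partial derivatives with respect to the $A$-th coordinate of $g$ and of $h$. Consider the conditions 1. $A^I_\mu(x,\sigma,gh)=A^A_\mu(x,\sigma,g)\,\partial^1_A\pi^I(g,h)+\eta^A_\mu(x,h)\,\partial^2_A\pi^I(g,h)$,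 2. $A^I_\Theta(x,\sigma,gh)=A^A_\Theta(x,\sigma,g)\,\partial^1_A\pi^I(g,h)$ (sums over $A$; the coefficients at $g$, $h$, $gh$ are taken in the charts of $G$ used there). Then: * $\omega$ is a generalized principal connection associated to $\eta$ if and only if, in all generalized principal bundle coordinates, for all charts of $G$ around $g$, $h$ and $gh$, conditions 1 and 2 hold for all indices, all $(x,\sigma)$ and all $g,h\in G$. * For the same equivalence it suffices to require 1 and 2, for all indices, all $(x,\sigma)$ and all $g,h\in G$, in one family of generalized principal bundle coordinates whose domains $V$ cover $\mathcal S$, with one fixed choice of a chart of $G$ around each point of $G$. -/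

import Mathlib

open scoped Manifold ContDiff Topology

noncomputable section

namespace GenPrincipal

/-! ### Smooth fiber bundles and (Ehresmann) connections -/

section Bundles

/-- The fibered product `X ×_B Y = {(x, y) | f x = g y}`. -/
def fiberProd {X Y B : Type*} (f : X → B) (g : Y → B) : Set (X × Y) :=
  {q | f q.1 = g q.2}

variable {EB HB EF HF EZ HZ : Type*}
  [NormedAddCommGroup EB] [NormedSpace ℝ EB] [TopologicalSpace HB]
  [NormedAddCommGroup EF] [NormedSpace ℝ EF] [TopologicalSpace HF]
  [NormedAddCommGroup EZ] [NormedSpace ℝ EZ] [TopologicalSpace HZ]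
  (IB : ModelWithCorners ℝ EB HB) (IF : ModelWithCorners ℝ EF HF) (IZ : ModelWithCorners ℝ EZ HZ)
  {B F Z : Type*} [TopologicalSpace B] [ChartedSpace HB B]
  [TopologicalSpace F] [ChartedSpace HF F] [TopologicalSpace Z] [ChartedSpace HZ Z]

/-- A local trivialization `π ⁻¹(U) → U × F` (over the open set `U = e.baseSet`) is smooth if it is
a diffeomorphism. -/
def IsSmoothTrivialization {π : Z → B} (e : Bundle.Trivialization F π) : Prop :=
  ContMDiffOn IZ (IB.prod IF) ∞ e e.source ∧
    ContMDiffOn (IB.prod IF) IZ ∞ e.toOpenPartialHomeomorph.symm e.target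

/-- `π : Z → B` is a smooth, locally trivial fiber bundle with typical fiber `F`. -/
def IsSmoothFiberBundle (F : Type*) [TopologicalSpace F] [ChartedSpace HF F] (π : Z → B) : Prop :=
  ContMDiff IZ IB ∞ π ∧
    ∀ b : B, ∃ e : Bundle.Trivialization F π, b ∈ e.baseSet ∧ IsSmoothTrivialization IB IF IZ e

/-- A connection on `π : Z → B`: a smooth vector bundle morphism `Ω : T(Z) → V(Z)` over the
identity of `Z`, where `V(Z) = ker T(π)`, which restricts to the identity on `V(Z)`. -/
structure Connection [IsManifold IZ ∞ Z] (π : Z → B) where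
  /-- the vertical projection `Ω_z : T_z(Z) → T_z(Z)` -/
  vert : ∀ z : Z, TangentSpace IZ z →L[ℝ] TangentSpace IZ z
  vert_mem : ∀ (z : Z) (v : TangentSpace IZ z), mfderiv IZ IB π z (vert z v) = 0
  vert_of_vertical : ∀ (z : Z) (v : TangentSpace IZ z), mfderiv IZ IB π z v = 0 → vert z v = v
  smooth : ContMDiff IZ.tangent IZ.tangent ∞
    (fun v : TangentBundle IZ Z => (⟨v.1, vert v.1 v.2⟩ : TangentBundle IZ Z))

variable {IB IZ}

/-- The horizontal lift `τ_z : T_{π z}(B) → T_z(Z)` of a connection: `τ_z(a)` is the horizontal part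
`v - Ω_z(v)` of any tangent vector `v` with `T_z(π)(v) = a`. (It does not depend on the choice of
`v`, two choices differing by a vertical vector; `T_z(π)` is onto when `π` is a fiber bundle.) -/
def Connection.lift [IsManifold IZ ∞ Z] {π : Z → B} (Ω : Connection IB IZ π) (z : Z) (a : TangentSpace IB (π z)) :
    TangentSpace IZ z :=
  let v : TangentSpace IZ z := Function.invFun (fun v => mfderiv IZ IB π z v) a
  v - Ω.vert z v

end Bundles

/-! ### Lie group fiber bundles -/

section LieGroupBundles

/-- A Lie group fiber bundle `π : 𝒢 → M` with typical fiber the Lie group `G`. The group structures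
of the fibers are given by functions on the total space; `mul γ δ` is meaningful only if `γ` and `δ`
are in the same fiber. Around every point of `M` there is a smooth local trivialization which is a
group isomorphism, hence a Lie group isomorphism, on each fiber. -/
structure LieGroupBundle {m l : ℕ} {M 𝒢 : Type*} (G : Type*)
    [TopologicalSpace M] [ChartedSpace (EuclideanSpace ℝ (Fin m)) M]
    [TopologicalSpace 𝒢] [ChartedSpace (EuclideanSpace ℝ (Fin (m + l))) 𝒢]
    [Group G] [TopologicalSpace G] [ChartedSpace (EuclideanSpace ℝ (Fin l)) G]
    (π : 𝒢 → M) where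
  /-- the unit section `x ↦ e_x` -/
  one : M → 𝒢
  /-- the multiplication `γ · δ` of two elements of the same fiber -/
  mul : 𝒢 → 𝒢 → 𝒢
  /-- the fiberwise inversion -/
  inv : 𝒢 → 𝒢
  proj_one : ∀ x, π (one x) = x
  proj_mul : ∀ γ δ, π γ = π δ → π (mul γ δ) = π γ
  proj_inv : ∀ γ, π (inv γ) = π γ
  one_mul : ∀ γ, mul (one (π γ)) γ = γ
  mul_one : ∀ γ, mul γ (one (π γ)) = γ
  inv_mul : ∀ γ, mul (inv γ) γ = one (π γ)
  mul_inv : ∀ γ, mul γ (inv γ) = one (π γ)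
  mul_assoc : ∀ γ δ ε, π γ = π δ → π δ = π ε → mul (mul γ δ) ε = mul γ (mul δ ε)
  smooth_proj : ContMDiff (𝓡 (m + l)) (𝓡 m) ∞ π
  exists_triv : ∀ x : M, ∃ e : Bundle.Trivialization G π, x ∈ e.baseSet ∧
    IsSmoothTrivialization (𝓡 m) (𝓡 l) (𝓡 (m + l)) e ∧
    ∀ γ δ, π γ = π δ → π γ ∈ e.baseSet → (e (mul γ δ)).2 = (e γ).2 * (e δ).2

variable {m l : ℕ} {M 𝒢 G : Type*}
  [TopologicalSpace M] [ChartedSpace (EuclideanSpace ℝ (Fin m)) M]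
  [TopologicalSpace 𝒢] [ChartedSpace (EuclideanSpace ℝ (Fin (m + l))) 𝒢]
  [Group G] [TopologicalSpace G] [ChartedSpace (EuclideanSpace ℝ (Fin l)) G]
  {π : 𝒢 → M}

/-- A local trivialization of a Lie group fiber bundle: a diffeomorphism `π ⁻¹(U) → U × G` which is
a group isomorphism on each fiber. -/
def LieGroupBundle.IsTrivialization (𝓑 : LieGroupBundle (m := m) (l := l) G π)
    (e : Bundle.Trivialization G π) : Prop :=
  IsSmoothTrivialization (𝓡 m) (𝓡 l) (𝓡 (m + l)) e ∧
    ∀ γ δ, π γ = π δ → π γ ∈ e.baseSet → (e (𝓑.mul γ δ)).2 = (e γ).2 * (e δ).2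

/-- The tangent map `T_δ(L_γ)` at `δ` of the left translation `L_γ : 𝒢_x → 𝒢_x`, `δ ↦ γ · δ`, of the
fiber over `x = π δ = π γ`; it is to be applied to vectors of `T_δ(𝒢_x) = V_δ(𝒢)` only. (The
derivative of a smooth map within a submanifold is unique on the vectors tangent to it.) -/
def LieGroupBundle.tangentL (𝓑 : LieGroupBundle (m := m) (l := l) G π) (γ δ : 𝒢) :
    TangentSpace (𝓡 (m + l)) δ →L[ℝ] TangentSpace (𝓡 (m + l)) (𝓑.mul γ δ) :=
  mfderivWithin (𝓡 (m + l)) (𝓡 (m + l)) (fun ε => 𝓑.mul γ ε) (π ⁻¹' {π δ}) δ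

end LieGroupBundles

/-! ### Fibered actions and generalized principal bundles -/

section Actions

/-- A (right) fibered action `Φ : P ×_M 𝒢 → P` of a Lie group fiber bundle on `πP : P → M`: a smooth
bundle morphism over the identity of `M` satisfying the axioms of a right action. The values of
`act` outside of the fibered product are irrelevant. -/
structure FiberedAction {m l n : ℕ} {M 𝒢 G P : Type*}
    [TopologicalSpace M] [ChartedSpace (EuclideanSpace ℝ (Fin m)) M]
    [TopologicalSpace 𝒢] [ChartedSpace (EuclideanSpace ℝ (Fin (m + l))) 𝒢]
    [Group G] [TopologicalSpace G] [ChartedSpace (EuclideanSpace ℝ (Fin l)) G]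
    [TopologicalSpace P] [ChartedSpace (EuclideanSpace ℝ (Fin (m + n))) P]
    {π : 𝒢 → M} (𝓑 : LieGroupBundle (m := m) (l := l) G π) (πP : P → M) where
  act : P × 𝒢 → P
  smooth : ContMDiffOn ((𝓡 (m + n)).prod (𝓡 (m + l))) (𝓡 (m + n)) ∞ act (fiberProd πP π)
  proj_act : ∀ p γ, πP p = π γ → πP (act (p, γ)) = πP p
  act_one : ∀ p, act (p, 𝓑.one (πP p)) = p
  act_mul : ∀ p γ δ, πP p = π γ → π γ = π δ → act (p, 𝓑.mul γ δ) = act (act (p, γ), δ)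

variable {m l n k : ℕ} {M 𝒢 G P : Type*}
  [TopologicalSpace M] [ChartedSpace (EuclideanSpace ℝ (Fin m)) M]
  [TopologicalSpace 𝒢] [ChartedSpace (EuclideanSpace ℝ (Fin (m + l))) 𝒢]
  [Group G] [TopologicalSpace G] [ChartedSpace (EuclideanSpace ℝ (Fin l)) G]
  [TopologicalSpace P] [ChartedSpace (EuclideanSpace ℝ (Fin (m + n))) P]
  {π : 𝒢 → M} {𝓑 : LieGroupBundle (m := m) (l := l) G π} {πP : P → M}

namespace FiberedAction

/-- The fibered action is free. -/
def IsFree (Φ : FiberedAction (n := n) 𝓑 πP) : Prop :=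
  ∀ p γ, πP p = π γ → Φ.act (p, γ) = p → γ = 𝓑.one (πP p)

/-- The fibered action is proper: preimages of compact sets under
`P ×_M 𝒢 → P ×_M P`, `(p, γ) ↦ (p, Φ(p, γ))`, are compact. -/
def IsProper (Φ : FiberedAction (n := n) 𝓑 πP) : Prop :=
  ∀ K : Set (P × P), K ⊆ fiberProd πP πP → IsCompact K →
    IsCompact {q : P × 𝒢 | q ∈ fiberProd πP π ∧ (q.1, Φ.act q) ∈ K}

/-- The equivalence relation `p₁ ∼ p₂ ↔ ∃ γ, Φ(p₁, γ) = p₂` on `P`. -/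
def orbitSetoid (Φ : FiberedAction (n := n) 𝓑 πP) : Setoid P where
  r p₁ p₂ := ∃ γ, πP p₁ = π γ ∧ Φ.act (p₁, γ) = p₂
  iseqv :=
    { refl := fun p => ⟨𝓑.one (πP p), (𝓑.proj_one _).symm, Φ.act_one p⟩
      symm := by
        rintro p₁ p₂ ⟨γ, h, rfl⟩
        refine ⟨𝓑.inv γ, ?_, ?_⟩
        · rw [Φ.proj_act _ _ h, h, 𝓑.proj_inv]
        · rw [← Φ.act_mul _ _ _ h (𝓑.proj_inv γ).symm, 𝓑.mul_inv, ← h, Φ.act_one]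
      trans := by
        rintro p₁ p₂ p₃ ⟨γ, h, rfl⟩ ⟨δ, h', rfl⟩
        have h2 : π γ = π δ := by rw [← h, ← h', Φ.proj_act _ _ h]
        refine ⟨𝓑.mul γ δ, ?_, ?_⟩
        · rw [𝓑.proj_mul _ _ h2, h]
        · rw [Φ.act_mul _ _ _ h h2] }

/-- The orbit space `𝒮 = P/𝒢`, with the quotient topology. -/
abbrev OrbitSpace (Φ : FiberedAction (n := n) 𝓑 πP) : Type _ := Quotient Φ.orbitSetoid

/-- The projection `π_{P,𝒮} : P → 𝒮`. -/
def toOrbit (Φ : FiberedAction (n := n) 𝓑 πP) (p : P) : Φ.OrbitSpace :=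
  Quotient.mk Φ.orbitSetoid p

/-- The projection `π_{𝒮,M} : 𝒮 → M`. -/
def orbitProj (Φ : FiberedAction (n := n) 𝓑 πP) : Φ.OrbitSpace → M :=
  Quotient.lift πP (by
    rintro p₁ p₂ ⟨γ, h, rfl⟩
    exact (Φ.proj_act _ _ h).symm)

/-- The tangent map `T_{(p,γ)}(Φ)`, to be applied only to the vectors `(z, v)` of
`T_{(p,γ)}(P ×_M 𝒢) = T_p(P) ×_{T_x(M)} T_γ(𝒢)`, where it is uniquely determined. -/
def tangentMap (Φ : FiberedAction (n := n) 𝓑 πP) (p : P) (γ : 𝒢)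
    (z : TangentSpace (𝓡 (m + n)) p) (v : TangentSpace (𝓡 (m + l)) γ) :
    TangentSpace (𝓡 (m + n)) (Φ.act (p, γ)) :=
  mfderivWithin ((𝓡 (m + n)).prod (𝓡 (m + l))) (𝓡 (m + n)) Φ.act (fiberProd πP π) (p, γ) (z, v)

/-- The tangent map `T_p(Φ_γ)` of `Φ_γ : P_x → P_x`, `q ↦ Φ(q, γ)`, to be applied only to the vectors
of `T_p(P_x)`. -/
def tangentR (Φ : FiberedAction (n := n) 𝓑 πP) (p : P) (γ : 𝒢) :
    TangentSpace (𝓡 (m + n)) p →L[ℝ] TangentSpace (𝓡 (m + n)) (Φ.act (p, γ)) :=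
  mfderivWithin (𝓡 (m + n)) (𝓡 (m + n)) (fun q => Φ.act (q, γ)) (πP ⁻¹' {πP p}) p

/-- The value `ξ^*_p = T_{e_x}(Φ_p)(ξ)` at `p ∈ P_x` of the generalized fundamental field of
`ξ ∈ T_{e_x}(𝒢_x)`, where `Φ_p : 𝒢_x → P_x`, `δ ↦ Φ(p, δ)`, so that `Φ_p(e_x) = p`. -/
def fundamental (Φ : FiberedAction (n := n) 𝓑 πP) (p : P)
    (ξ : TangentSpace (𝓡 (m + l)) (𝓑.one (πP p))) : TangentSpace (𝓡 (m + n)) p :=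
  mfderivWithin (𝓡 (m + l)) (𝓡 (m + n)) (fun δ => Φ.act (p, δ)) (π ⁻¹' {πP p})
    (𝓑.one (πP p)) ξ

variable [IsManifold (𝓡 (m + l)) ∞ 𝒢] [IsManifold (𝓡 (m + n)) ∞ P]
  (Φ : FiberedAction (n := n) 𝓑 πP)
  [ChartedSpace (EuclideanSpace ℝ (Fin (m + k))) Φ.OrbitSpace]

/-- The connection `Ω` on `(P, 𝒮, π_{P,𝒮}, G)` is a generalized principal connection associated to
the connection `ν` on `(𝒢, M, π, G)`:
`Ω (T(Φ)(z, v)) = T(Φ_γ)(Ω z) + (T(L_{γ⁻¹})(ν v))^*` for all `(p, γ) ∈ P ×_M 𝒢` and all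
`(z, v) ∈ T_p(P) ×_{T_x(M)} T_γ(𝒢)`. -/
def IsGeneralizedPrincipalConnection
    (Ω : Connection (𝓡 (m + k)) (𝓡 (m + n)) Φ.toOrbit)
    (ν : Connection (𝓡 m) (𝓡 (m + l)) π) : Prop :=
  ∀ (p : P) (γ : 𝒢), πP p = π γ →
    ∀ (z : TangentSpace (𝓡 (m + n)) p) (v : TangentSpace (𝓡 (m + l)) γ),
      (mfderiv (𝓡 (m + n)) (𝓡 m) πP p z : EuclideanSpace ℝ (Fin m)) =
        mfderiv (𝓡 (m + l)) (𝓡 m) π γ v →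
      Ω.vert (Φ.act (p, γ)) (Φ.tangentMap p γ z v) =
        Φ.tangentR p γ (Ω.vert p z) +
          Φ.fundamental (Φ.act (p, γ)) (𝓑.tangentL (𝓑.inv γ) γ (ν.vert γ v))

/-! ### Generalized principal bundle coordinates -/

/-- The data of generalized principal bundle coordinates `(x^μ, σ^Θ, g^I)`, up to the choice of
coordinates `g^I` on the Lie group `G`: a local trivialization of `𝒢` over an open `U ⊆ M`,
coordinates `x^μ` on an open subset of `U`, fibered coordinates `(x^μ, σ^Θ)` on an open subset `V` of
`𝒮`, and a smooth local section `V → P` of `π_{P,𝒮}`. -/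
structure Coordinates where
  /-- the local trivialization of `𝒢`, over the open set `U` -/
  triv : Bundle.Trivialization G π
  isTriv : 𝓑.IsTrivialization triv
  /-- the coordinates `x^μ` on `M` -/
  chartM : OpenPartialHomeomorph M (EuclideanSpace ℝ (Fin m))
  chartM_mem : chartM ∈ IsManifold.maximalAtlas (𝓡 m) ∞ M
  chartM_source : chartM.source ⊆ triv.baseSet
  /-- the fibered coordinates `(x^μ, σ^Θ)` on the open set `V = chartS.source` of `𝒮` -/
  chartS : OpenPartialHomeomorph Φ.OrbitSpace
    (EuclideanSpace ℝ (Fin m) × EuclideanSpace ℝ (Fin k))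
  chartS_smooth : ContMDiffOn (𝓡 (m + k))
    𝓘(ℝ, EuclideanSpace ℝ (Fin m) × EuclideanSpace ℝ (Fin k)) ∞ chartS chartS.source
  chartS_symm_smooth : ContMDiffOn
    𝓘(ℝ, EuclideanSpace ℝ (Fin m) × EuclideanSpace ℝ (Fin k)) (𝓡 (m + k)) ∞
    chartS.symm chartS.target
  chartS_source : ∀ s ∈ chartS.source, Φ.orbitProj s ∈ chartM.source
  chartS_fst : ∀ s ∈ chartS.source, (chartS s).1 = chartM (Φ.orbitProj s)
  /-- the local section of `π_{P,𝒮}` -/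
  sec : Φ.OrbitSpace → P
  sec_smooth : ContMDiffOn (𝓡 (m + k)) (𝓡 (m + n)) ∞ sec chartS.source
  toOrbit_sec : ∀ s ∈ chartS.source, Φ.toOrbit (sec s) = s

end FiberedAction

namespace FiberedAction.Coordinates

variable [IsManifold (𝓡 (m + l)) ∞ 𝒢] [IsManifold (𝓡 (m + n)) ∞ P]
  {Φ : FiberedAction (n := n) 𝓑 πP}
  [ChartedSpace (EuclideanSpace ℝ (Fin (m + k))) Φ.OrbitSpace]
  (C : Φ.Coordinates (k := k))

/-- The point of `𝒢` with coordinates `x = (x^μ)` and group coordinate `h ∈ G`. -/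
def grpPoint (x : EuclideanSpace ℝ (Fin m)) (h : G) : 𝒢 :=
  C.triv.toOpenPartialHomeomorph.symm (C.chartM.symm x, h)

/-- The inverse of the local trivialization of `π_{P,𝒮}` over `V`:
`(s, g) ↦ Φ(sec s, γ)`, where `γ ∈ 𝒢_x`, `x = π_{𝒮,M}(s)`, has group coordinate `g`. -/
def trivSymm (s : Φ.OrbitSpace) (g : G) : P :=
  Φ.act (C.sec s, C.triv.toOpenPartialHomeomorph.symm (Φ.orbitProj s, g))

/-- The group coordinate `g ∈ G` of a point `p` with `π_{P,𝒮}(p) ∈ V`: the only `g` with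
`p = trivSymm (π_{P,𝒮}(p)) g`. -/
def grpCoord (p : P) : G :=
  Function.invFun (fun g => C.trivSymm (Φ.toOrbit p) g) p

/-- The point of `P` with coordinates `y = (x^μ, σ^Θ)` and group coordinate `g ∈ G`. -/
def point (y : EuclideanSpace ℝ (Fin m) × EuclideanSpace ℝ (Fin k)) (g : G) : P :=
  C.trivSymm (C.chartS.symm y) g

/-- The tangent vector `a^μ ∂_μ + a^Θ ∂_Θ` of `𝒮` at the point with coordinates `y`. -/
def tangentS (y a : EuclideanSpace ℝ (Fin m) × EuclideanSpace ℝ (Fin k)) :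
    TangentSpace (𝓡 (m + k)) (C.chartS.symm y) :=
  mfderiv 𝓘(ℝ, EuclideanSpace ℝ (Fin m) × EuclideanSpace ℝ (Fin k)) (𝓡 (m + k)) C.chartS.symm y a

/-- The tangent vector `a^μ ∂_μ` of `M` at the point with coordinates `x`. -/
def tangentM (x a : EuclideanSpace ℝ (Fin m)) : TangentSpace (𝓡 m) (C.chartM.symm x) :=
  mfderiv 𝓘(ℝ, EuclideanSpace ℝ (Fin m)) (𝓡 m) C.chartM.symm x a

/-- With the coordinates `g^I = κ^I` on `G` around `g`, the number `a^μ A^I_μ + a^Θ A^I_Θ` at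
`(x, σ, g)`, `y = (x, σ)`, for the connection coefficients of `Ω`, i.e.
`τ_p(a^μ ∂_μ + a^Θ ∂_Θ) = a^μ (∂_μ - A^I_μ ∂_I) + a^Θ (∂_Θ - A^I_Θ ∂_I)`; so it is
`- dg^I (τ_p(a^μ ∂_μ + a^Θ ∂_Θ))`. -/
def coeff (Ω : Connection (𝓡 (m + k)) (𝓡 (m + n)) Φ.toOrbit)
    (κ : OpenPartialHomeomorph G (EuclideanSpace ℝ (Fin l)))
    (y : EuclideanSpace ℝ (Fin m) × EuclideanSpace ℝ (Fin k)) (g : G)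
    (a : EuclideanSpace ℝ (Fin m) × EuclideanSpace ℝ (Fin k)) (I : Fin l) : ℝ :=
  -(show ℝ from mfderiv (𝓡 (m + n)) 𝓘(ℝ, ℝ) (fun q => κ (C.grpCoord q) I) (C.point y g)
    (Ω.lift (C.point y g) (C.tangentS y a)))

/-- The connection coefficient `A^I_μ(x, σ, g)`. -/
def coeffBase (Ω : Connection (𝓡 (m + k)) (𝓡 (m + n)) Φ.toOrbit)
    (κ : OpenPartialHomeomorph G (EuclideanSpace ℝ (Fin l)))
    (y : EuclideanSpace ℝ (Fin m) × EuclideanSpace ℝ (Fin k)) (g : G)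
    (I : Fin l) (μ : Fin m) : ℝ :=
  C.coeff Ω κ y g (EuclideanSpace.single μ 1, 0) I

/-- The connection coefficient `A^I_Θ(x, σ, g)`. -/
def coeffFiber (Ω : Connection (𝓡 (m + k)) (𝓡 (m + n)) Φ.toOrbit)
    (κ : OpenPartialHomeomorph G (EuclideanSpace ℝ (Fin l)))
    (y : EuclideanSpace ℝ (Fin m) × EuclideanSpace ℝ (Fin k)) (g : G)
    (I : Fin l) (Θ : Fin k) : ℝ :=
  C.coeff Ω κ y g (0, EuclideanSpace.single Θ 1) I

/-- The connection coefficient `η^I_μ(x, h)` of a connection on `𝒢`, defined by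
`η_γ(∂_μ) = ∂_μ - η^I_μ(x, h) ∂_I`, in the coordinates `h^I = κ^I` on `G` around `h`. -/
def grpCoeff (η : Connection (𝓡 m) (𝓡 (m + l)) π)
    (κ : OpenPartialHomeomorph G (EuclideanSpace ℝ (Fin l)))
    (x : EuclideanSpace ℝ (Fin m)) (h : G) (I : Fin l) (μ : Fin m) : ℝ :=
  -(show ℝ from mfderiv (𝓡 (m + l)) 𝓘(ℝ, ℝ) (fun δ => κ (C.triv δ).2 I) (C.grpPoint x h)
    (η.lift (C.grpPoint x h) (C.tangentM x (EuclideanSpace.single μ 1))))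

end FiberedAction.Coordinates

/-- `∂¹_A π^I(g, h)`: the partial derivative of the local expression `κ₃ (κ₁⁻¹(u) · κ₂⁻¹(w))` of the
multiplication of `G` with respect to `u^A`, at `u = κ₁ g`, with `κ₂⁻¹(w) = h`. -/
def partialMulLeft (κ₁ κ₃ : OpenPartialHomeomorph G (EuclideanSpace ℝ (Fin l))) (g h : G)
    (A I : Fin l) : ℝ :=
  fderiv ℝ (fun u => κ₃ (κ₁.symm u * h) I) (κ₁ g) (EuclideanSpace.single A 1)

/-- `∂²_A π^I(g, h)`: the partial derivative of the local expression `κ₃ (κ₁⁻¹(u) · κ₂⁻¹(w))` of the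
multiplication of `G` with respect to `w^A`, at `w = κ₂ h`, with `κ₁⁻¹(u) = g`. -/
def partialMulRight (κ₂ κ₃ : OpenPartialHomeomorph G (EuclideanSpace ℝ (Fin l))) (g h : G)
    (A I : Fin l) : ℝ :=
  fderiv ℝ (fun w => κ₃ (g * κ₂.symm w) I) (κ₂ h) (EuclideanSpace.single A 1)

/-- The two identities, for all indices, at the point with coordinates `y = (x, σ)` of `𝒮` and at
`g, h ∈ G`, where `κ₁`, `κ₂`, `κ₃` are the coordinates used on `G` around `g`, `h` and `g * h`. -/
def FiberedAction.Coordinates.CoeffIdentities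
    [IsManifold (𝓡 (m + l)) ∞ 𝒢] [IsManifold (𝓡 (m + n)) ∞ P] {Φ : FiberedAction (n := n) 𝓑 πP}
    [ChartedSpace (EuclideanSpace ℝ (Fin (m + k))) Φ.OrbitSpace]
    (C : Φ.Coordinates (k := k))
    (Ω : Connection (𝓡 (m + k)) (𝓡 (m + n)) Φ.toOrbit)
    (η : Connection (𝓡 m) (𝓡 (m + l)) π)
    (κ₁ κ₂ κ₃ : OpenPartialHomeomorph G (EuclideanSpace ℝ (Fin l)))
    (y : EuclideanSpace ℝ (Fin m) × EuclideanSpace ℝ (Fin k)) (g h : G) : Prop :=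
  (∀ (I : Fin l) (μ : Fin m), C.coeffBase Ω κ₃ y (g * h) I μ =
    (∑ A, C.coeffBase Ω κ₁ y g A μ * partialMulLeft κ₁ κ₃ g h A I) +
      ∑ A, C.grpCoeff η κ₂ y.1 h A μ * partialMulRight κ₂ κ₃ g h A I) ∧
  (∀ (I : Fin l) (Θ : Fin k), C.coeffFiber Ω κ₃ y (g * h) I Θ =
    ∑ A, C.coeffFiber Ω κ₁ y g A Θ * partialMulLeft κ₁ κ₃ g h A I)

end Actions

end GenPrincipal

end

/-! In adapted coordinates a connection is the projection `(a, b) ↦ (0, b + A a)`, where `a` is the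
base component, `b` the group component and `A` is a linear map whose matrix entries are the
connection coefficients. The action reads `(x, σ, g) · (x, h) = (x, σ, g h)`. Let `m'` be the
derivative of the product of `G` at `(g, h)` in charts, and let `a₁` be the `∂_μ` part of `a`. Then
`T(Φ)` takes `((a, b), (a₁, b'))` to `(a, m'(b, b'))`, and `T(Φ_γ)` takes `(0, b)` to `(0, m'(b,
0))`. Since `Φ(Φ(p, γ), γ⁻¹ δ) = Φ(p, δ)`, left translation by `γ⁻¹` followed by the fundamental
vector takes `(0, b')` to `(0, m'(0, b'))`.

The defining equation becomes `m'(b, b') + A₃ a = m'(b + A₁ a, 0) + m'(0, b' + N a₁)`, with `A₁`,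
`A₃`, `N` the coefficient maps at `g`, `g h` and `h`. The terms in `b` and `b'` cancel, leaving `A₃
a = m'(A₁ a, N a₁)`. On the vectors `∂_μ` this is condition 1, and on the vectors `∂_Θ`, where `a₁ =
0`, it is condition 2. This is `coeffIdentities_iff`; it is pointwise, so one coordinate system
around each point is enough.

The remaining work is to show that the coordinates deserve the name. Those of `P` are built from a
section and the action, and the group coordinate is a chosen preimage. By `eq_zero_of_equivariant`
an injective orbit map is an immersion; a dimension count then gives `pointTangent_bijective`, and
the inverse function theorem gives `mdifferentiableAt_grpCoord`. Coordinates exist around every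
orbit (`exists_coordinates`) because `P → M` is a submersion that factors through `𝒮 → M`, so the
latter is one too and has adapted charts by `exists_chart_fst_eq`. -/

noncomputable section

namespace GenPrincipal

/-! ### Chain rules for derivatives within a subset. -/

section General

variable {E EX HX EY HY : Type*} [NormedAddCommGroup E] [NormedSpace ℝ E]
  [NormedAddCommGroup EX] [NormedSpace ℝ EX] [TopologicalSpace HX]
  [NormedAddCommGroup EY] [NormedSpace ℝ EY] [TopologicalSpace HY]
  {I : ModelWithCorners ℝ EX HX} {J : ModelWithCorners ℝ EY HY}
  {X Y : Type*} [TopologicalSpace X] [ChartedSpace HX X] [TopologicalSpace Y] [ChartedSpace HY Y]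

/-- The chain rule, in a form that does not depend on how the base points are written. -/
theorem hasMFDerivAt_comp_of_mdifferentiableWithinAt {f : E → X} {g : X → Y} {s : Set X} {x : X}
    {u : E} {f' : E →L[ℝ] EX} (hx : f u = x)
    (hg : MDifferentiableWithinAt I J g s x) (hf : HasMFDerivAt 𝓘(ℝ, E) I f u f')
    (hs : ∀ᶠ v in 𝓝 u, f v ∈ s) :
    HasMFDerivAt 𝓘(ℝ, E) J (fun v => g (f v)) u
      ((show EX →L[ℝ] EY from mfderivWithin I J g s x).comp f') := by
  subst hx
  exact (hg.hasMFDerivWithinAt.comp u (hf.hasMFDerivWithinAt (s := f ⁻¹' s))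
    subset_rfl).hasMFDerivAt hs

/-- Computes tangent maps of maps that are differentiable only within a fibre or a fibered product.
No unique differentiability of `s` is required: `mfderivWithin` is one derivative within `s`, and
the chain rule along a parametrization `f` with values in `s` fixes its values on the range of `f'`.
-/
theorem mfderivWithin_apply_of_comp {f : E → X} {g : X → Y} {h : E → Y} {s : Set X} {x : X}
    {u : E} {f' : E →L[ℝ] EX} {h' : E →L[ℝ] EY} (hx : f u = x)
    (hg : MDifferentiableWithinAt I J g s x) (hf : HasMFDerivAt 𝓘(ℝ, E) I f u f')
    (hs : ∀ᶠ v in 𝓝 u, f v ∈ s) (hh : HasMFDerivAt 𝓘(ℝ, E) J h u h')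
    (heq : ∀ᶠ v in 𝓝 u, g (f v) = h v) (a : E) :
    (mfderivWithin I J g s x (f' a) : EY) = h' a :=
  DFunLike.congr_fun (hasMFDerivAt_unique
    (hasMFDerivAt_comp_of_mdifferentiableWithinAt hx hg hf hs)
    (hh.congr_of_eventuallyEq (f₁ := fun v => g (f v)) heq)) a

theorem mfderiv_apply_of_comp {f : E → X} {g : X → Y} {h : E → Y} {x : X}
    {u : E} {f' : E →L[ℝ] EX} {h' : E →L[ℝ] EY} (hx : f u = x)
    (hg : MDifferentiableAt I J g x) (hf : HasMFDerivAt 𝓘(ℝ, E) I f u f')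
    (hh : HasMFDerivAt 𝓘(ℝ, E) J h u h')
    (heq : ∀ᶠ v in 𝓝 u, g (f v) = h v) (a : E) :
    (mfderiv I J g x (f' a) : EY) = h' a := by
  have := mfderivWithin_apply_of_comp (s := Set.univ) hx hg.mdifferentiableWithinAt hf
    (by simp) hh heq a
  rwa [mfderivWithin_univ] at this

end General

/-! ### Generalized principal bundle coordinates as set-theoretic bijections, and their smoothness.
-/

section Charts

set_option linter.unusedSectionVars false

variable {m l n k : ℕ} {M 𝒢 G P : Type*}
  [TopologicalSpace M] [ChartedSpace (EuclideanSpace ℝ (Fin m)) M] [IsManifold (𝓡 m) ∞ M]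
  [TopologicalSpace 𝒢] [ChartedSpace (EuclideanSpace ℝ (Fin (m + l))) 𝒢]
  [Group G] [TopologicalSpace G] [ChartedSpace (EuclideanSpace ℝ (Fin l)) G]
  [TopologicalSpace P] [ChartedSpace (EuclideanSpace ℝ (Fin (m + n))) P]
  {π : 𝒢 → M} {𝓑 : LieGroupBundle (m := m) (l := l) G π} {πP : P → M}

theorem LieGroupBundle.mul_symm {e : Bundle.Trivialization G π} (he : 𝓑.IsTrivialization e)
    {x : M} (hx : x ∈ e.baseSet) (g h : G) :
    𝓑.mul (e.toOpenPartialHomeomorph.symm (x, g)) (e.toOpenPartialHomeomorph.symm (x, h)) =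
      e.toOpenPartialHomeomorph.symm (x, g * h) := by
  have hg : π (e.toOpenPartialHomeomorph.symm (x, g)) = x := e.proj_symm_apply' hx
  have hh : π (e.toOpenPartialHomeomorph.symm (x, h)) = x := e.proj_symm_apply' hx
  have hgh : π (e.toOpenPartialHomeomorph.symm (x, g * h)) = x := e.proj_symm_apply' hx
  have hm := (𝓑.proj_mul _ _ (hg.trans hh.symm)).trans hg
  have hmem : ∀ {γ : 𝒢}, π γ = x → π γ ∈ e.baseSet := fun h => h.symm ▸ hx
  have hsnd : ∀ g, (e (e.toOpenPartialHomeomorph.symm (x, g))).2 = g := fun g =>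
    congrArg Prod.snd (e.apply_symm_apply' (x := g) hx)
  apply e.injOn (e.mem_source.2 (hmem hm)) (e.mem_source.2 (hmem hgh))
  refine Prod.ext ?_ ?_
  · exact (e.coe_fst' (hmem hm)).trans (hm.trans (hgh.symm.trans (e.coe_fst' (hmem hgh)).symm))
  · refine (he.2 _ _ (hg.trans hh.symm) (hmem hg)).trans ?_
    rw [hsnd, hsnd]
    exact (hsnd _).symm

theorem LieGroupBundle.eq_of_mul_inv {γ δ : 𝒢} (h : π γ = π δ)
    (h1 : 𝓑.mul γ (𝓑.inv δ) = 𝓑.one (π γ)) : γ = δ := by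
  have := 𝓑.mul_assoc γ (𝓑.inv δ) δ (by rw [𝓑.proj_inv, h]) (𝓑.proj_inv δ)
  rw [h1, 𝓑.inv_mul, ← h, 𝓑.mul_one, h, 𝓑.one_mul] at this
  exact this.symm

/-- If `γ` and `δ` move `p` to the same point, then `γ δ⁻¹` fixes `p`, so it is the unit. -/
theorem FiberedAction.IsFree.injective {Φ : FiberedAction (n := n) 𝓑 πP} (hfree : Φ.IsFree)
    {p : P} {γ δ : 𝒢} (hγ : πP p = π γ) (hδ : πP p = π δ)
    (h : Φ.act (p, γ) = Φ.act (p, δ)) : γ = δ := by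
  have hγδ : π γ = π δ := hγ.symm.trans hδ
  apply 𝓑.eq_of_mul_inv hγδ
  have hp : π γ = π (𝓑.inv δ) := hγδ.trans (𝓑.proj_inv δ).symm
  rw [← hγ]
  apply hfree
  · rw [𝓑.proj_mul _ _ hp, hγ]
  · rw [Φ.act_mul _ _ _ hγ hp, h, ← Φ.act_mul _ _ _ hδ (𝓑.proj_inv δ).symm, 𝓑.mul_inv, ← hδ,
      Φ.act_one]

namespace FiberedAction.Coordinates

variable [IsManifold (𝓡 (m + l)) ∞ 𝒢] [IsManifold (𝓡 (m + n)) ∞ P]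
  {Φ : FiberedAction (n := n) 𝓑 πP}
  [ChartedSpace (EuclideanSpace ℝ (Fin (m + k))) Φ.OrbitSpace]
  (C : Φ.Coordinates (k := k))

theorem proj_sec {s : Φ.OrbitSpace} (hs : s ∈ C.chartS.source) :
    πP (C.sec s) = Φ.orbitProj s := by
  conv_rhs => rw [← C.toOrbit_sec s hs]
  rfl

variable {y : EuclideanSpace ℝ (Fin m) × EuclideanSpace ℝ (Fin k)} (hy : y ∈ C.chartS.target)

include hy

theorem fst_mem_target : y.1 ∈ C.chartM.target := by
  have hs := C.chartS.map_target hy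
  have := C.chartS_fst _ hs
  rw [C.chartS.right_inv hy] at this
  rw [this]
  exact C.chartM.map_source (C.chartS_source _ hs)

theorem orbitProj_symm : Φ.orbitProj (C.chartS.symm y) = C.chartM.symm y.1 := by
  have hs := C.chartS.map_target hy
  have := C.chartS_fst _ hs
  rw [C.chartS.right_inv hy] at this
  rw [this, C.chartM.left_inv (C.chartS_source _ hs)]

theorem point_eq (g : G) :
    C.point y g = Φ.act (C.sec (C.chartS.symm y), C.grpPoint y.1 g) := by
  rw [point, trivSymm, grpPoint, C.orbitProj_symm hy]

omit hy in
theorem mem_baseSet {x : EuclideanSpace ℝ (Fin m)} (hx : x ∈ C.chartM.target) :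
    C.chartM.symm x ∈ C.triv.baseSet :=
  C.chartM_source (C.chartM.map_target hx)

omit hy in
theorem proj_grpPoint {x : EuclideanSpace ℝ (Fin m)} (hx : x ∈ C.chartM.target) (h : G) :
    π (C.grpPoint x h) = C.chartM.symm x :=
  C.triv.proj_symm_apply' (C.mem_baseSet hx)

omit hy in
theorem triv_grpPoint {x : EuclideanSpace ℝ (Fin m)} (hx : x ∈ C.chartM.target) (h : G) :
    C.triv (C.grpPoint x h) = (C.chartM.symm x, h) :=
  C.triv.apply_symm_apply' (C.mem_baseSet hx)

omit hy in
theorem exists_grpPoint {x : EuclideanSpace ℝ (Fin m)} (hx : x ∈ C.chartM.target) {γ : 𝒢}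
    (hγ : π γ = C.chartM.symm x) : ∃ h, γ = C.grpPoint x h := by
  refine ⟨(C.triv γ).2, ?_⟩
  have hmem : π γ ∈ C.triv.baseSet := hγ ▸ C.mem_baseSet hx
  rw [grpPoint, ← hγ]
  exact (C.triv.symm_apply_mk_proj (C.triv.mem_source.2 hmem)).symm

omit hy in
theorem mul_grpPoint {x : EuclideanSpace ℝ (Fin m)} (hx : x ∈ C.chartM.target) (g h : G) :
    𝓑.mul (C.grpPoint x g) (C.grpPoint x h) = C.grpPoint x (g * h) :=
  𝓑.mul_symm C.isTriv (C.mem_baseSet hx) g h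

theorem proj_sec_symm (g : G) : πP (C.sec (C.chartS.symm y)) = π (C.grpPoint y.1 g) := by
  rw [C.proj_sec (C.chartS.map_target hy), C.orbitProj_symm hy,
    C.proj_grpPoint (C.fst_mem_target hy)]

theorem proj_point (g : G) : πP (C.point y g) = C.chartM.symm y.1 := by
  rw [C.point_eq hy, Φ.proj_act _ _ (C.proj_sec_symm hy g), C.proj_sec_symm hy g,
    C.proj_grpPoint (C.fst_mem_target hy)]

theorem act_point (g h : G) :
    Φ.act (C.point y g, C.grpPoint y.1 h) = C.point y (g * h) := by
  have hx := C.fst_mem_target hy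
  rw [C.point_eq hy, C.point_eq hy, ← Φ.act_mul _ _ _ (C.proj_sec_symm hy g)
    ((C.proj_grpPoint hx g).trans (C.proj_grpPoint hx h).symm), C.mul_grpPoint hx]

theorem toOrbit_point (g : G) : Φ.toOrbit (C.point y g) = C.chartS.symm y := by
  conv_rhs => rw [← C.toOrbit_sec _ (C.chartS.map_target hy)]
  rw [C.point_eq hy]
  exact Quotient.sound (Φ.orbitSetoid.symm ⟨_, C.proj_sec_symm hy g, rfl⟩)

theorem point_injective (hfree : Φ.IsFree) : Function.Injective (C.point y) := by
  intro g h hgh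
  have hx := C.fst_mem_target hy
  rw [C.point_eq hy, C.point_eq hy] at hgh
  have := hfree.injective (C.proj_sec_symm hy g) (C.proj_sec_symm hy h) hgh
  have := congrArg C.triv this
  rw [C.triv_grpPoint hx, C.triv_grpPoint hx] at this
  exact (Prod.ext_iff.1 this).2

theorem exists_point {p : P} (hp : Φ.toOrbit p = C.chartS.symm y) : ∃ g, p = C.point y g := by
  have hx := C.fst_mem_target hy
  have : Φ.toOrbit (C.sec (C.chartS.symm y)) = Φ.toOrbit p :=
    (C.toOrbit_sec _ (C.chartS.map_target hy)).trans hp.symm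
  obtain ⟨γ, hγ, rfl⟩ := Quotient.exact this
  obtain ⟨g, rfl⟩ := C.exists_grpPoint hx (hγ.symm.trans
    ((C.proj_sec_symm hy 1).trans (C.proj_grpPoint hx 1)))
  exact ⟨g, (C.point_eq hy g).symm⟩

/-- Freeness makes `C.point y` injective, so the `invFun` in `grpCoord` is a true left inverse.
Every later use of `grpCoord` goes through this. -/
theorem grpCoord_point (hfree : Φ.IsFree) (g : G) : C.grpCoord (C.point y g) = g := by
  have h := C.point_injective hy hfree
  rw [grpCoord, C.toOrbit_point hy]
  exact Function.leftInverse_invFun h g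

omit hy in
theorem contMDiffAt_grpPoint {x : EuclideanSpace ℝ (Fin m)} (hx : x ∈ C.chartM.target)
    {κ : OpenPartialHomeomorph G (EuclideanSpace ℝ (Fin l))}
    (hκ : κ ∈ IsManifold.maximalAtlas (𝓡 l) ∞ G) {w : EuclideanSpace ℝ (Fin l)}
    (hw : w ∈ κ.target) :
    ContMDiffAt 𝓘(ℝ, EuclideanSpace ℝ (Fin m) × EuclideanSpace ℝ (Fin l)) (𝓡 (m + l)) ∞
      (fun u : EuclideanSpace ℝ (Fin m) × EuclideanSpace ℝ (Fin l) =>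
        C.grpPoint u.1 (κ.symm u.2)) (x, w) := by
  have h1 : ContMDiffAt ((𝓡 m).prod (𝓡 l)) (𝓡 (m + l)) ∞
      C.triv.toOpenPartialHomeomorph.symm (C.chartM.symm x, κ.symm w) :=
    C.isTriv.1.2.contMDiffAt (C.triv.open_target.mem_nhds
      (C.triv.mem_target.2 (C.mem_baseSet hx)))
  have hM := contMDiffAt_symm_of_mem_maximalAtlas C.chartM_mem hx
  have hG := contMDiffAt_symm_of_mem_maximalAtlas hκ hw
  exact h1.comp (x, w) ((hM.comp (x, w) (contDiff_fst.contMDiff.contMDiffAt)).prodMk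
    (hG.comp (x, w) (contDiff_snd.contMDiff.contMDiffAt)))

theorem contMDiffAt_point
    {κ : OpenPartialHomeomorph G (EuclideanSpace ℝ (Fin l))}
    (hκ : κ ∈ IsManifold.maximalAtlas (𝓡 l) ∞ G) {w : EuclideanSpace ℝ (Fin l)}
    (hw : w ∈ κ.target) :
    ContMDiffAt 𝓘(ℝ, (EuclideanSpace ℝ (Fin m) × EuclideanSpace ℝ (Fin k)) ×
        EuclideanSpace ℝ (Fin l)) (𝓡 (m + n)) ∞
      (fun u : (EuclideanSpace ℝ (Fin m) × EuclideanSpace ℝ (Fin k)) × EuclideanSpace ℝ (Fin l) =>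
        C.point u.1 (κ.symm u.2)) (y, w) := by
  have hx := C.fst_mem_target hy
  have hS : ContMDiffAt 𝓘(ℝ, EuclideanSpace ℝ (Fin m) × EuclideanSpace ℝ (Fin k)) (𝓡 (m + k)) ∞
      C.chartS.symm y := C.chartS_symm_smooth.contMDiffAt (C.chartS.open_target.mem_nhds hy)
  have hs : ContMDiffAt (𝓡 (m + k)) (𝓡 (m + n)) ∞ C.sec (C.chartS.symm y) :=
    C.sec_smooth.contMDiffAt (C.chartS.open_source.mem_nhds (C.chartS.map_target hy))
  have h1 := (hs.comp y hS).comp (y, w)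
    (contDiff_fst (𝕜 := ℝ) (F := EuclideanSpace ℝ (Fin l))).contMDiff.contMDiffAt
  have hγ := (C.contMDiffAt_grpPoint hx hκ hw).comp
    (f := fun u : (EuclideanSpace ℝ (Fin m) × EuclideanSpace ℝ (Fin k)) ×
      EuclideanSpace ℝ (Fin l) => (u.1.1, u.2)) (y, w)
    ((contDiff_fst.fst.prodMk contDiff_snd).contMDiff.contMDiffAt)
  -- The action is smooth only on the fibered product, and the pair (section, group point) is known
  -- to lie there only over `C.chartS.target`. The composition is therefore taken within this open
  -- set.
  have hO : IsOpen (C.chartS.target ×ˢ (Set.univ : Set (EuclideanSpace ℝ (Fin l)))) :=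
    C.chartS.open_target.prod isOpen_univ
  have hmem : (y, w) ∈ C.chartS.target ×ˢ (Set.univ : Set (EuclideanSpace ℝ (Fin l))) :=
    ⟨hy, trivial⟩
  have h2 := (h1.prodMk hγ).contMDiffWithinAt
    (s := C.chartS.target ×ˢ (Set.univ : Set (EuclideanSpace ℝ (Fin l))))
  have h3 := (Φ.smooth _ (C.proj_sec_symm hy (κ.symm w))).comp (y, w) h2
    (fun u hu => C.proj_sec_symm hu.1 _)
  refine (h3.contMDiffAt (hO.mem_nhds hmem)).congr_of_eventuallyEq ?_
  filter_upwards [hO.mem_nhds hmem] with u hu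
  exact C.point_eq hu.1 _

end FiberedAction.Coordinates

end Charts

/-! ### Injective orbit maps of Lie groups are immersions. -/

section Equivariant

variable {l : ℕ} {G : Type*} [Group G] [TopologicalSpace G]
  [ChartedSpace (EuclideanSpace ℝ (Fin l)) G] [LieGroup (𝓡 l) ∞ G]

/-- The multiplication of a Lie group is smooth in charts. -/
theorem contDiffAt_mul_of_mem_maximalAtlas
    {κ₁ κ₂ κ₃ : OpenPartialHomeomorph G (EuclideanSpace ℝ (Fin l))}
    (h₁ : κ₁ ∈ IsManifold.maximalAtlas (𝓡 l) ∞ G) (h₂ : κ₂ ∈ IsManifold.maximalAtlas (𝓡 l) ∞ G)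
    (h₃ : κ₃ ∈ IsManifold.maximalAtlas (𝓡 l) ∞ G) {u w : EuclideanSpace ℝ (Fin l)}
    (hu : u ∈ κ₁.target) (hw : w ∈ κ₂.target) (c : G)
    (huw : κ₁.symm u * c * κ₂.symm w ∈ κ₃.source) :
    ContDiffAt ℝ ∞ (fun v : EuclideanSpace ℝ (Fin l) × EuclideanSpace ℝ (Fin l) =>
      κ₃ (κ₁.symm v.1 * c * κ₂.symm v.2)) (u, w) := by
  have e1 : ContMDiffAt 𝓘(ℝ, EuclideanSpace ℝ (Fin l) × EuclideanSpace ℝ (Fin l)) (𝓡 l) ∞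
      (fun v : EuclideanSpace ℝ (Fin l) × EuclideanSpace ℝ (Fin l) => κ₁.symm v.1) (u, w) :=
    (contMDiffAt_symm_of_mem_maximalAtlas h₁ hu).comp (u, w)
      (contDiff_fst.contMDiff.contMDiffAt)
  have e2 : ContMDiffAt 𝓘(ℝ, EuclideanSpace ℝ (Fin l) × EuclideanSpace ℝ (Fin l)) (𝓡 l) ∞
      (fun v : EuclideanSpace ℝ (Fin l) × EuclideanSpace ℝ (Fin l) => κ₂.symm v.2) (u, w) :=
    (contMDiffAt_symm_of_mem_maximalAtlas h₂ hw).comp (u, w)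
      (contDiff_snd.contMDiff.contMDiffAt)
  have e3 := (e1.mul (contMDiffAt_const (c := c))).mul e2
  exact ((contMDiffAt_of_mem_maximalAtlas h₃ huw).comp (u, w) e3).contDiffAt

variable {EX HX : Type*} [NormedAddCommGroup EX] [NormedSpace ℝ EX] [TopologicalSpace HX]
  {I : ModelWithCorners ℝ EX HX} {X : Type*} [TopologicalSpace X] [ChartedSpace HX X]
  [IsManifold I ∞ X]

/-- A curve in a manifold with vanishing derivative is locally constant. -/
theorem eventually_eq_of_hasMFDerivAt_zero {c : ℝ → X}
    (hc : ∀ᶠ t in 𝓝 (0 : ℝ), HasMFDerivAt 𝓘(ℝ, ℝ) I c t (0 : ℝ →L[ℝ] EX)) :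
    ∀ᶠ t in 𝓝 (0 : ℝ), c t = c 0 := by
  have hcont : ContinuousAt c 0 := hc.self_of_nhds.continuousAt
  have hs : ∀ᶠ t in 𝓝 (0 : ℝ), c t ∈ (chartAt HX (c 0)).source :=
    hcont ((chartAt HX (c 0)).open_source.mem_nhds (mem_chart_source HX (c 0)))
  obtain ⟨ε, hε, hball⟩ := Metric.eventually_nhds_iff_ball.1 (hc.and hs)
  have hd : ∀ t ∈ Metric.ball (0 : ℝ) ε,
      HasFDerivAt (fun t => extChartAt I (c 0) (c t)) (0 : ℝ →L[ℝ] EX) t := by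
    intro t ht
    obtain ⟨h1, h2⟩ := hball t ht
    have : IsManifold I 1 X := .of_le (n := ∞) (by simp)
    have h3 := (mdifferentiableAt_extChartAt (I := I) h2).hasMFDerivAt.comp t h1
    have h4 := h3.hasFDerivAt
    refine h4.congr_fderiv (ContinuousLinearMap.ext fun r => ?_)
    exact ContinuousLinearMap.map_zero (mfderiv I 𝓘(ℝ, EX) (extChartAt I (c 0)) (c t))
  filter_upwards [Metric.ball_mem_nhds (0 : ℝ) hε] with t ht
  have h := (convex_ball (0 : ℝ) ε).is_const_of_fderivWithin_eq_zero (𝕜 := ℝ)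
    (f := fun t => extChartAt I (c 0) (c t))
    (fun t ht => (hd t ht).differentiableAt.differentiableWithinAt)
    (fun t ht => (hd t ht).hasFDerivWithinAt.fderivWithin
      (Metric.isOpen_ball.uniqueDiffWithinAt ht)) ht (Metric.mem_ball_self hε)
  exact (extChartAt I (c 0)).injOn (by rw [extChartAt_source]; exact (hball t ht).2)
    (mem_extChartAt_source (c 0)) h

/-- An injective orbit map of a Lie group is an immersion. -/
theorem eq_zero_of_equivariant {θ : G → X} (hθ : Function.Injective θ) {S : Set X}
    (hS : ∀ g, θ g ∈ S) (R : G → X → X) (hR : ∀ g h, R h (θ g) = θ (g * h))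
    (hRd : ∀ g h, MDifferentiableWithinAt I I (R h) S (θ g))
    {κ : OpenPartialHomeomorph G (EuclideanSpace ℝ (Fin l))}
    (hκ : κ ∈ IsManifold.maximalAtlas (𝓡 l) ∞ G)
    (hθd : ∀ u ∈ κ.target, MDifferentiableAt (𝓡 l) I (fun u => θ (κ.symm u)) u)
    {w : EuclideanSpace ℝ (Fin l)} (hw : w ∈ κ.target)
    {f' : EuclideanSpace ℝ (Fin l) →L[ℝ] EX}
    (hf : HasMFDerivAt (𝓡 l) I (fun u => θ (κ.symm u)) w f')
    {a : EuclideanSpace ℝ (Fin l)} (ha : f' a = 0) : a = 0 := by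
  set g := κ.symm w with hg
  -- In the chart, `μ u` is the right translation that carries `g` to `κ.symm u`.
  let μ : EuclideanSpace ℝ (Fin l) → EuclideanSpace ℝ (Fin l) → EuclideanSpace ℝ (Fin l) :=
    fun u v => κ (κ.symm v * g⁻¹ * κ.symm u)
  have hμ : ContDiffAt ℝ ∞ (Function.uncurry μ) (w, w) := by
    have h := contDiffAt_mul_of_mem_maximalAtlas hκ hκ hκ hw hw g⁻¹
      (by rw [← hg, mul_inv_cancel, one_mul]; exact κ.map_target hw)
    exact h.comp (f := Prod.swap) (w, w) (contDiff_snd.prodMk contDiff_fst).contDiffAt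
  -- The invariant vector field under right translations with value `a` at `g`. It is `C¹`, as the
  -- existence of integral curves requires.
  let V : EuclideanSpace ℝ (Fin l) → EuclideanSpace ℝ (Fin l) := fun u => fderiv ℝ (μ u) w a
  have hV : ContDiffAt ℝ 1 V w :=
    (ContDiffAt.fderiv (f := μ) (g := fun _ => w) (m := 1) hμ contDiffAt_const
      (by norm_cast)).clm_apply contDiffAt_const
  have hsymm : ContinuousOn κ.symm κ.target := κ.continuousOn_symm
  have hVw : V w = a := by
    have h1 : μ w =ᶠ[𝓝 w] id := by
      filter_upwards [κ.open_target.mem_nhds hw] with v hv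
      simp only [μ, ← hg, inv_mul_cancel_right, id, κ.right_inv hv]
    simp only [V, h1.fderiv_eq, fderiv_id, ContinuousLinearMap.id_apply]
  have hdiff : ∀ᶠ u in 𝓝 w, DifferentiableAt ℝ (μ u) w := by
    have h1 := (hμ.of_le (m := 1) (by norm_cast)).eventually (by simp)
    have h2 : Filter.Tendsto (fun u : EuclideanSpace ℝ (Fin l) => (u, w)) (𝓝 w) (𝓝 (w, w)) :=
      (continuous_id.prodMk continuous_const).continuousAt
    filter_upwards [h2.eventually h1] with u hu
    exact (hu.differentiableAt (by simp)).comp (f := fun v => (u, v)) w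
      ((differentiableAt_const u).prodMk differentiableAt_id)
  -- Equivariance spreads the kernel: near `w`, `θ` after the translation `μ u` equals `R (g⁻¹ *
  -- κ.symm u)` after `θ`, so the derivative of `θ` on `V u` is the image of `f' a = 0`.
  have hzero : ∀ᶠ u in 𝓝 w, ∀ F : EuclideanSpace ℝ (Fin l) →L[ℝ] EX,
      HasMFDerivAt (𝓡 l) I (fun u => θ (κ.symm u)) u F → F (V u) = 0 := by
    filter_upwards [hdiff, κ.open_target.mem_nhds hw] with u hu hut F hF
    have hμu : μ u w = u := by simp only [μ, ← hg, mul_inv_cancel, one_mul, κ.right_inv hut]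
    have h1 : HasMFDerivAt (𝓡 l) (𝓡 l) (μ u) w (fderiv ℝ (μ u) w) :=
      hu.hasFDerivAt.hasMFDerivAt
    have hF' : HasMFDerivAt (𝓡 l) I (fun u => θ (κ.symm u)) (μ u w) F := by rwa [hμu]
    have h2 := hF'.comp w h1
    have hcont : ContinuousAt (fun v => κ.symm v * g⁻¹ * κ.symm u) w := by
      have : ContinuousMul G := continuousMul_of_contMDiffMul (𝓡 l) ∞
      have := hsymm.continuousAt (κ.open_target.mem_nhds hw)
      exact (this.mul continuousAt_const).mul continuousAt_const
    have hev : ∀ᶠ v in 𝓝 w, κ.symm v * g⁻¹ * κ.symm u ∈ κ.source := by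
      apply hcont
      apply κ.open_source.mem_nhds
      change κ.symm w * g⁻¹ * κ.symm u ∈ κ.source
      rw [← hg, mul_inv_cancel, one_mul]
      exact κ.map_target hut
    have := mfderivWithin_apply_of_comp (E := EuclideanSpace ℝ (Fin l))
      (f := fun u => θ (κ.symm u)) (g := R (g⁻¹ * κ.symm u)) (x := θ g)
      (by rw [hg]) (hRd g (g⁻¹ * κ.symm u)) hf (Filter.Eventually.of_forall fun v => hS _) h2
      (by
        filter_upwards [hev] with v hv
        simp only [hR, Function.comp, μ, κ.left_inv hv]
        rw [mul_assoc]) a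
    rw [ha] at this
    exact this.symm.trans (ContinuousLinearMap.map_zero _)
  -- Along an integral curve `α` of `V`, `θ` has zero derivative, so it is constant. Injectivity of
  -- `θ` forces `α` itself to be constant, and its velocity `a` at time 0 vanishes.
  obtain ⟨α, hα0, ε, hε, hα⟩ :=
    hV.exists_forall_mem_closedBall_exists_eq_forall_mem_Ioo_hasDerivAt₀ 0
  have hεn : Set.Ioo (0 - ε) (0 + ε) ∈ 𝓝 (0 : ℝ) := Ioo_mem_nhds (by linarith) (by linarith)
  have hαc : Filter.Tendsto α (𝓝 0) (𝓝 w) := by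
    have := (hα 0 (mem_of_mem_nhds hεn)).continuousAt
    rwa [ContinuousAt, hα0] at this
  have hconst : ∀ᶠ t in 𝓝 (0 : ℝ), θ (κ.symm (α t)) = θ (κ.symm (α 0)) := by
    apply eventually_eq_of_hasMFDerivAt_zero (I := I)
    filter_upwards [hεn, hαc.eventually hzero, hαc (κ.open_target.mem_nhds hw)] with t ht hz hmem
    have h1 := (hθd _ hmem).hasMFDerivAt
    have h2 : HasMFDerivAt 𝓘(ℝ, ℝ) (𝓡 l) α t _ := (hα t ht).hasFDerivAt.hasMFDerivAt
    have h3 := h1.comp t h2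
    refine h3.congr_mfderiv (ContinuousLinearMap.ext fun r => ?_)
    have h4 := hz _ h1
    refine (ContinuousLinearMap.map_smul (mfderiv (𝓡 l) I (fun u => θ (κ.symm u)) (α t))
      r (V (α t))).trans ?_
    exact (congrArg (fun x : EX => (show ℝ from r) • x) h4).trans (smul_zero (show ℝ from r))
  have hαw : α =ᶠ[𝓝 0] fun _ => w := by
    filter_upwards [hconst, hαc (κ.open_target.mem_nhds hw)] with t ht hmem
    rw [hα0] at ht
    exact κ.symm.injOn hmem hw (hθ ht)
  have h1 := (hα 0 (mem_of_mem_nhds hεn)).unique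
    ((hasDerivAt_const (0 : ℝ) w).congr_of_eventuallyEq hαw)
  rw [hα0, hVw] at h1
  exact h1

end Equivariant

/-! ### The tangent space of `P` in coordinates and the differential of the group coordinate. -/

section Charts

set_option linter.unusedSectionVars false

variable {m l n k : ℕ} {M 𝒢 G P : Type*}
  [TopologicalSpace M] [ChartedSpace (EuclideanSpace ℝ (Fin m)) M] [IsManifold (𝓡 m) ∞ M]
  [TopologicalSpace 𝒢] [ChartedSpace (EuclideanSpace ℝ (Fin (m + l))) 𝒢]
  [Group G] [TopologicalSpace G] [ChartedSpace (EuclideanSpace ℝ (Fin l)) G]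
  [LieGroup (𝓡 l) ∞ G]
  [TopologicalSpace P] [ChartedSpace (EuclideanSpace ℝ (Fin (m + n))) P]
  {π : 𝒢 → M} {𝓑 : LieGroupBundle (m := m) (l := l) G π} {πP : P → M}

theorem FiberedAction.mdifferentiableWithinAt_act (Φ : FiberedAction (n := n) 𝓑 πP) {p : P} {γ : 𝒢}
    (h : πP p = π γ) :
    MDifferentiableWithinAt ((𝓡 (m + n)).prod (𝓡 (m + l))) (𝓡 (m + n)) Φ.act (fiberProd πP π)
      (p, γ) :=
  (Φ.smooth (p, γ) h).mdifferentiableWithinAt (by simp)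

theorem FiberedAction.mdifferentiableWithinAt_act_left (Φ : FiberedAction (n := n) 𝓑 πP)
    {p : P} {γ : 𝒢} (h : πP p = π γ) :
    MDifferentiableWithinAt (𝓡 (m + n)) (𝓡 (m + n)) (fun q => Φ.act (q, γ)) (πP ⁻¹' {πP p}) p :=
  (Φ.mdifferentiableWithinAt_act h).comp (f := fun q => (q, γ)) p
    ((mdifferentiableAt_id.prodMk mdifferentiableAt_const).mdifferentiableWithinAt)
    (fun q (hq : πP q = πP p) => hq.trans h)

theorem FiberedAction.mdifferentiableWithinAt_act_right (Φ : FiberedAction (n := n) 𝓑 πP)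
    {p : P} {γ : 𝒢} (h : πP p = π γ) :
    MDifferentiableWithinAt (𝓡 (m + l)) (𝓡 (m + n)) (fun δ => Φ.act (p, δ)) (π ⁻¹' {πP p}) γ :=
  (Φ.mdifferentiableWithinAt_act h).comp (f := fun δ => (p, δ)) γ
    ((mdifferentiableAt_const.prodMk mdifferentiableAt_id).mdifferentiableWithinAt)
    (fun δ (hδ : π δ = πP p) => hδ.symm)

variable [IsManifold (𝓡 (m + l)) ∞ 𝒢] [IsManifold (𝓡 (m + n)) ∞ P]
  {Φ : FiberedAction (n := n) 𝓑 πP}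
  [ChartedSpace (EuclideanSpace ℝ (Fin (m + k))) Φ.OrbitSpace]

/-- A smooth trivialization has invertible differential, so the dimensions of total space and
product agree. This is what ties `k` to `n`. -/
theorem FiberedAction.dim_eq
    (hS : IsSmoothFiberBundle (𝓡 (m + k)) (𝓡 l) (𝓡 (m + n)) G Φ.toOrbit) (p : P) :
    m + n = m + k + l := by
  obtain ⟨e, he, h1, h2⟩ := hS.2 (Φ.toOrbit p)
  have hd : e.toOpenPartialHomeomorph.MDifferentiable (𝓡 (m + n)) ((𝓡 (m + k)).prod (𝓡 l)) :=
    ⟨h1.mdifferentiableOn (by simp), h2.mdifferentiableOn (by simp)⟩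
  have E : EuclideanSpace ℝ (Fin (m + n)) ≃L[ℝ]
      EuclideanSpace ℝ (Fin (m + k)) × EuclideanSpace ℝ (Fin l) :=
    hd.mfderiv (x := p) (e.mem_source.2 he)
  simpa using E.toLinearEquiv.finrank_eq

namespace FiberedAction.Coordinates

variable (C : Φ.Coordinates (k := k))

/-- The inverse of the chart of `P` given by generalized principal bundle coordinates and a chart
`κ` of `G`. -/
def pointChart (κ : OpenPartialHomeomorph G (EuclideanSpace ℝ (Fin l)))
    (u : (EuclideanSpace ℝ (Fin m) × EuclideanSpace ℝ (Fin k)) × EuclideanSpace ℝ (Fin l)) : P :=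
  C.point u.1 (κ.symm u.2)

/-- The inverse of the chart of `𝒢` given by generalized principal bundle coordinates and a chart
`κ` of `G`. -/
def grpChart (κ : OpenPartialHomeomorph G (EuclideanSpace ℝ (Fin l)))
    (u : EuclideanSpace ℝ (Fin m) × EuclideanSpace ℝ (Fin l)) : 𝒢 :=
  C.grpPoint u.1 (κ.symm u.2)

/-- The tangent vector of `P` with given components in generalized principal bundle coordinates. -/
def pointTangent (κ : OpenPartialHomeomorph G (EuclideanSpace ℝ (Fin l)))
    (y : EuclideanSpace ℝ (Fin m) × EuclideanSpace ℝ (Fin k)) (g : G) :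
    (EuclideanSpace ℝ (Fin m) × EuclideanSpace ℝ (Fin k)) × EuclideanSpace ℝ (Fin l) →L[ℝ]
      EuclideanSpace ℝ (Fin (m + n)) :=
  mfderiv 𝓘(ℝ, (EuclideanSpace ℝ (Fin m) × EuclideanSpace ℝ (Fin k)) × EuclideanSpace ℝ (Fin l))
    (𝓡 (m + n)) (C.pointChart κ) (y, κ g)

/-- The tangent vector of `𝒢` with given components in generalized principal bundle coordinates. -/
def grpTangent (κ : OpenPartialHomeomorph G (EuclideanSpace ℝ (Fin l)))
    (x : EuclideanSpace ℝ (Fin m)) (h : G) :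
    EuclideanSpace ℝ (Fin m) × EuclideanSpace ℝ (Fin l) →L[ℝ] EuclideanSpace ℝ (Fin (m + l)) :=
  mfderiv 𝓘(ℝ, EuclideanSpace ℝ (Fin m) × EuclideanSpace ℝ (Fin l)) (𝓡 (m + l))
    (C.grpChart κ) (x, κ h)

variable {κ : OpenPartialHomeomorph G (EuclideanSpace ℝ (Fin l))} {g : G}

theorem pointChart_apply (y : EuclideanSpace ℝ (Fin m) × EuclideanSpace ℝ (Fin k))
    (hg : g ∈ κ.source) : C.pointChart κ (y, κ g) = C.point y g := by
  rw [pointChart, κ.left_inv hg]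

theorem grpChart_apply (x : EuclideanSpace ℝ (Fin m)) (hg : g ∈ κ.source) :
    C.grpChart κ (x, κ g) = C.grpPoint x g := by
  rw [grpChart, κ.left_inv hg]

variable {y : EuclideanSpace ℝ (Fin m) × EuclideanSpace ℝ (Fin k)} (hy : y ∈ C.chartS.target)
  (hκ : κ ∈ IsManifold.maximalAtlas (𝓡 l) ∞ G) (hg : g ∈ κ.source)

include hκ hg

theorem hasMFDerivAt_grpChart {x : EuclideanSpace ℝ (Fin m)} (hx : x ∈ C.chartM.target) :
    HasMFDerivAt 𝓘(ℝ, EuclideanSpace ℝ (Fin m) × EuclideanSpace ℝ (Fin l)) (𝓡 (m + l))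
      (C.grpChart κ) (x, κ g) (C.grpTangent κ x g) :=
  ((C.contMDiffAt_grpPoint hx hκ (κ.map_source hg)).mdifferentiableAt (by simp)).hasMFDerivAt

include hy

theorem hasMFDerivAt_pointChart :
    HasMFDerivAt 𝓘(ℝ, (EuclideanSpace ℝ (Fin m) × EuclideanSpace ℝ (Fin k)) ×
        EuclideanSpace ℝ (Fin l)) (𝓡 (m + n))
      (C.pointChart κ) (y, κ g) (C.pointTangent κ y g) :=
  ((C.contMDiffAt_point hy hκ (κ.map_source hg)).mdifferentiableAt (by simp)).hasMFDerivAt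

omit hκ hg in
theorem hasMFDerivAt_chartS_symm :
    HasMFDerivAt 𝓘(ℝ, EuclideanSpace ℝ (Fin m) × EuclideanSpace ℝ (Fin k)) (𝓡 (m + k))
      C.chartS.symm y (mfderiv 𝓘(ℝ, EuclideanSpace ℝ (Fin m) × EuclideanSpace ℝ (Fin k))
        (𝓡 (m + k)) C.chartS.symm y) :=
  ((C.chartS_symm_smooth.contMDiffAt (C.chartS.open_target.mem_nhds hy)).mdifferentiableAt
    (by simp)).hasMFDerivAt

omit hκ hg in
theorem tangentS_eq_zero {a : EuclideanSpace ℝ (Fin m) × EuclideanSpace ℝ (Fin k)}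
    (ha : C.tangentS y a = 0) : a = 0 := by
  have h := mfderiv_apply_of_comp (f := C.chartS.symm) (g := C.chartS) (h := id) rfl
    ((C.chartS_smooth.contMDiffAt (C.chartS.open_source.mem_nhds
      (C.chartS.map_target hy))).mdifferentiableAt (by simp))
    (C.hasMFDerivAt_chartS_symm hy) (hasMFDerivAt_id y)
    (by
      filter_upwards [C.chartS.open_target.mem_nhds hy] with v hv
      exact C.chartS.right_inv hv) a
  refine h.symm.trans ?_
  refine (congrArg _ ha).trans ?_
  exact ContinuousLinearMap.map_zero _

theorem mfderiv_toOrbit_pointTangent (hd : MDifferentiable (𝓡 (m + n)) (𝓡 (m + k)) Φ.toOrbit)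
    (a : EuclideanSpace ℝ (Fin m) × EuclideanSpace ℝ (Fin k)) (b : EuclideanSpace ℝ (Fin l)) :
    (mfderiv (𝓡 (m + n)) (𝓡 (m + k)) Φ.toOrbit (C.point y g) (C.pointTangent κ y g (a, b)) :
      EuclideanSpace ℝ (Fin (m + k))) = C.tangentS y a := by
  have h2 := (C.hasMFDerivAt_chartS_symm hy).comp (y, κ g)
    (hasFDerivAt_fst (𝕜 := ℝ) (p := (y, κ g))).hasMFDerivAt
  exact mfderiv_apply_of_comp (C.pointChart_apply y hg) (hd _)
    (C.hasMFDerivAt_pointChart hy hκ hg) h2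
    (by
      filter_upwards [(continuous_fst.tendsto (y, κ g)) (C.chartS.open_target.mem_nhds hy)]
        with v hv
      exact C.toOrbit_point hv _) (a, b)

/-- Projecting to `𝒮` kills the component `a`; what is left is the differential of the orbit map `g
↦ C.point y g`, an immersion by `eq_zero_of_equivariant`. The right translations used there are the
maps `Φ_γ` on a fibre of `P → M`. -/
theorem pointTangent_eq_zero (hfree : Φ.IsFree)
    (hd : MDifferentiable (𝓡 (m + n)) (𝓡 (m + k)) Φ.toOrbit)
    {v : (EuclideanSpace ℝ (Fin m) × EuclideanSpace ℝ (Fin k)) × EuclideanSpace ℝ (Fin l)}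
    (hv : C.pointTangent κ y g v = 0) : v = 0 := by
  obtain ⟨a, b⟩ := v
  have hx := C.fst_mem_target hy
  have ha : a = 0 := by
    apply C.tangentS_eq_zero hy
    refine (C.mfderiv_toOrbit_pointTangent hy hκ hg hd a b).symm.trans ?_
    refine (congrArg _ hv).trans ?_
    exact ContinuousLinearMap.map_zero _
  subst ha
  have key : ∀ u ∈ κ.target, HasMFDerivAt (𝓡 l) (𝓡 (m + n)) (fun u => C.point y (κ.symm u)) u
      ((C.pointTangent κ y (κ.symm u)).comp (ContinuousLinearMap.inr ℝ _ _)) := by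
    intro u hu
    have h1 := C.hasMFDerivAt_pointChart hy hκ (κ.map_target hu)
    rw [κ.right_inv hu] at h1
    exact h1.comp u (hasFDerivAt_prodMk_right y u).hasMFDerivAt
  have hb := key _ (κ.map_source hg)
  rw [κ.left_inv hg] at hb
  have : b = 0 := eq_zero_of_equivariant (C.point_injective hy hfree)
    (S := πP ⁻¹' {C.chartM.symm y.1}) (fun g => C.proj_point hy g)
    (fun h q => Φ.act (q, C.grpPoint y.1 h)) (fun g h => C.act_point hy g h)
    (fun g h => by
      have := Φ.mdifferentiableWithinAt_act_left (p := C.point y g) (γ := C.grpPoint y.1 h)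
        ((C.proj_point hy g).trans (C.proj_grpPoint hx h).symm)
      rwa [C.proj_point hy] at this)
    hκ (fun u hu => (key u hu).mdifferentiableAt) (κ.map_source hg) hb hv
  rw [this]
  rfl

theorem pointTangent_bijective (hfree : Φ.IsFree)
    (hS : IsSmoothFiberBundle (𝓡 (m + k)) (𝓡 l) (𝓡 (m + n)) G Φ.toOrbit) :
    Function.Bijective (C.pointTangent κ y g) := by
  have hinj : Function.Injective (C.pointTangent κ y g).toLinearMap :=
    (injective_iff_map_eq_zero _).2 fun v hv =>
      C.pointTangent_eq_zero hy hκ hg hfree (hS.1.mdifferentiable (by simp)) hv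
  refine ⟨hinj, (LinearMap.injective_iff_surjective_of_finrank_eq_finrank ?_).1 hinj⟩
  have := Φ.dim_eq hS (C.point y g)
  simp only [Module.finrank_prod, finrank_euclideanSpace, Fintype.card_fin]
  omega

/-- `grpCoord` is defined by choice, so its regularity comes from the inverse function theorem
applied to `pointChart` read in a chart of `P`: near the point it must agree with the group
component of the local inverse. -/
theorem mdifferentiableAt_grpCoord (hfree : Φ.IsFree)
    (hS : IsSmoothFiberBundle (𝓡 (m + k)) (𝓡 l) (𝓡 (m + n)) G Φ.toOrbit) :
    MDifferentiableAt (𝓡 (m + n)) (𝓡 l) (fun q => κ (C.grpCoord q)) (C.point y g) := by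
  have h1n : IsManifold (𝓡 (m + n)) 1 P := .of_le (n := ∞) (by simp)
  set p := C.point y g with hp
  set φ := extChartAt (𝓡 (m + n)) p with hφ
  have hpc : C.pointChart κ (y, κ g) = p := C.pointChart_apply y hg
  have hsm := C.contMDiffAt_point hy hκ (κ.map_source hg)
  have hφs : MDifferentiableAt (𝓡 (m + n)) 𝓘(ℝ, EuclideanSpace ℝ (Fin (m + n))) φ p :=
    mdifferentiableAt_extChartAt (mem_chart_source _ p)
  have hH : ContDiffAt ℝ ∞ (fun u => φ (C.pointChart κ u)) (y, κ g) :=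
    ((contMDiffAt_extChartAt (I := 𝓡 (m + n)) (n := ∞) (x := p)).comp_of_eq hsm hpc).contDiffAt
  have hHd : ∀ v, fderiv ℝ (fun u => φ (C.pointChart κ u)) (y, κ g) v =
      mfderiv (𝓡 (m + n)) 𝓘(ℝ, EuclideanSpace ℝ (Fin (m + n))) φ p (C.pointTangent κ y g v) := by
    intro v
    exact (mfderiv_apply_of_comp hpc hφs (C.hasMFDerivAt_pointChart hy hκ hg)
      (hH.differentiableAt (by simp)).hasFDerivAt.hasMFDerivAt
      (Filter.Eventually.of_forall fun _ => rfl) v).symm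
  have hbij : Function.Bijective (fderiv ℝ (fun u => φ (C.pointChart κ u)) (y, κ g)) := by
    have h1 : Function.Bijective
        (mfderiv (𝓡 (m + n)) 𝓘(ℝ, EuclideanSpace ℝ (Fin (m + n))) φ p) :=
      (isInvertible_mfderiv_extChartAt (mem_extChartAt_source (I := 𝓡 (m + n)) p)).bijective
    exact (funext hHd) ▸ h1.comp (C.pointTangent_bijective hy hκ hg hfree hS)
  let L := (LinearEquiv.ofBijective
    (fderiv ℝ (fun u => φ (C.pointChart κ u)) (y, κ g)).toLinearMap hbij).toContinuousLinearEquiv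
  have hL : HasStrictFDerivAt (fun u => φ (C.pointChart κ u)) (L : _ →L[ℝ] _) (y, κ g) :=
    hH.hasStrictFDerivAt (by simp)
  have hφp : φ p = (fun u => φ (C.pointChart κ u)) (y, κ g) := congrArg φ hpc.symm
  set Ψ := hL.localInverse _ _ _ with hΨ
  have hΨp : Ψ (φ p) = (y, κ g) := by rw [hφp]; exact hL.localInverse_apply_image
  have hΨd : DifferentiableAt ℝ (fun v => (Ψ v).2) (φ p) := by
    rw [hφp]
    exact hL.to_localInverse.hasFDerivAt.differentiableAt.snd
  have hΨc : ContinuousAt Ψ (φ p) := by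
    rw [hφp]
    exact hL.to_localInverse.hasFDerivAt.continuousAt
  have hφc : ContinuousAt φ p := hφs.continuousAt
  have hcont : Filter.Tendsto (fun q => Ψ (φ q)) (𝓝 p) (𝓝 (y, κ g)) := by
    have := hΨc.tendsto.comp hφc.tendsto
    rwa [hΨp] at this
  have hpcont : Filter.Tendsto (C.pointChart κ) (𝓝 (y, κ g)) (𝓝 p) := by
    have := (C.hasMFDerivAt_pointChart hy hκ hg).continuousAt
    rwa [ContinuousAt, hpc] at this
  have hφmem : φ.source ∈ 𝓝 p := extChartAt_source_mem_nhds p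
  have hright : ∀ᶠ v in 𝓝 (φ p), φ (C.pointChart κ (Ψ v)) = v := by
    rw [hφp]
    exact hL.eventually_right_inverse
  refine (hΨd.mdifferentiableAt.comp p hφs).congr_of_eventuallyEq ?_
  -- The local inverse only gives equality after applying `φ`. Keeping both `q` and `C.pointChart κ
  -- (Ψ (φ q))` in the chart source lets injectivity of `φ` remove it.
  filter_upwards [hφmem, hcont.eventually (hpcont.eventually hφmem), hφc.eventually hright,
    hcont ((C.chartS.open_target.prod κ.open_target).mem_nhds ⟨hy, κ.map_source hg⟩)]
    with q hq hq' hqr hqm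
  have hqe : C.pointChart κ (Ψ (φ q)) = q := φ.injOn hq' hq hqr
  conv_lhs => rw [← hqe]
  rw [pointChart, C.grpCoord_point hqm.1 hfree, κ.right_inv hqm.2]
  rfl

/-- The differential of the group coordinates reads off the last components. -/
theorem mfderiv_grpCoord_pointTangent (hfree : Φ.IsFree)
    (hS : IsSmoothFiberBundle (𝓡 (m + k)) (𝓡 l) (𝓡 (m + n)) G Φ.toOrbit)
    (v : (EuclideanSpace ℝ (Fin m) × EuclideanSpace ℝ (Fin k)) × EuclideanSpace ℝ (Fin l))
    (I : Fin l) :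
    (mfderiv (𝓡 (m + n)) 𝓘(ℝ, ℝ) (fun q => κ (C.grpCoord q) I) (C.point y g)
      (C.pointTangent κ y g v) : ℝ) = v.2 I := by
  have hd : MDifferentiableAt (𝓡 (m + n)) 𝓘(ℝ, ℝ) (fun q => κ (C.grpCoord q) I) (C.point y g) :=
    ((EuclideanSpace.proj (𝕜 := ℝ) I).differentiableAt.mdifferentiableAt).comp _
      (C.mdifferentiableAt_grpCoord hy hκ hg hfree hS)
  let L : (EuclideanSpace ℝ (Fin m) × EuclideanSpace ℝ (Fin k)) × EuclideanSpace ℝ (Fin l) →L[ℝ] ℝ :=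
    (EuclideanSpace.proj (𝕜 := ℝ) I).comp (ContinuousLinearMap.snd ℝ _ _)
  exact mfderiv_apply_of_comp (h := L) (C.pointChart_apply y hg) hd
    (C.hasMFDerivAt_pointChart hy hκ hg) L.hasFDerivAt.hasMFDerivAt
    (by
      filter_upwards [(C.chartS.open_target.prod κ.open_target).mem_nhds ⟨hy, κ.map_source hg⟩]
        with u hu
      rw [pointChart, C.grpCoord_point hu.1 hfree, κ.right_inv hu.2]
      rfl) v

end FiberedAction.Coordinates

end Charts

/-! ### Linear algebra of a connection at a point. -/

section Connections

variable {EB HB EZ HZ B Z : Type*}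
  [NormedAddCommGroup EB] [NormedSpace ℝ EB] [TopologicalSpace HB]
  [NormedAddCommGroup EZ] [NormedSpace ℝ EZ] [TopologicalSpace HZ]
  {IB : ModelWithCorners ℝ EB HB} {IZ : ModelWithCorners ℝ EZ HZ}
  [TopologicalSpace B] [ChartedSpace HB B] [TopologicalSpace Z] [ChartedSpace HZ Z]
  [IsManifold IZ ∞ Z] {p : Z → B} (Ω : Connection IB IZ p)

/-- Two preimages of `a` differ by a vertical vector, which `vert` fixes, so the choice made by
`invFun` in `lift` is immaterial. -/
theorem Connection.lift_eq {z : Z} {a : TangentSpace IB (p z)}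
    {v : TangentSpace IZ z} (hv : mfderiv IZ IB p z v = a) :
    Ω.lift z a = v - Ω.vert z v := by
  set w : TangentSpace IZ z := Function.invFun (fun v => mfderiv IZ IB p z v) a with hw
  have h1 : mfderiv IZ IB p z w = a :=
    Function.invFun_eq (f := fun v => mfderiv IZ IB p z v) ⟨v, hv⟩
  have h2 : Ω.vert z (w - v) = w - v := by
    apply Ω.vert_of_vertical
    rw [map_sub, h1, hv, sub_self]
  rw [map_sub] at h2
  change w - Ω.vert z w = v - Ω.vert z v
  rw [sub_eq_sub_iff_sub_eq_sub, h2]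

/-- The local form of a connection in coordinates adapted to the fibration. -/
theorem Connection.exists_coeff {l : ℕ} {EA : Type*} [NormedAddCommGroup EA] [NormedSpace ℝ EA]
    {z : Z} {D : EA × EuclideanSpace ℝ (Fin l) →L[ℝ] EZ} (hD : Function.Bijective D)
    {T : EA → EB} (hT : ∀ a, T a = 0 → a = 0)
    (hDT : ∀ a b, (mfderiv IZ IB p z (D (a, b)) : EB) = T a)
    {ℓ : Fin l → (EZ →L[ℝ] ℝ)} (hℓ : ∀ I v, ℓ I (D v) = v.2 I) :
    ∃ A : EA →ₗ[ℝ] EuclideanSpace ℝ (Fin l),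
      (∀ a b, (Ω.vert z (D (a, b)) : EZ) = D (0, b + A a)) ∧
      ∀ a I, -(ℓ I (Ω.lift z (T a))) = A a I := by
  let Ve : EZ →L[ℝ] EZ := Ω.vert z
  let e : (EA × EuclideanSpace ℝ (Fin l)) ≃ₗ[ℝ] EZ := LinearEquiv.ofBijective D.toLinearMap hD
  have hDe : ∀ v, D v = e v := fun _ => rfl
  let A : EA →ₗ[ℝ] EuclideanSpace ℝ (Fin l) :=
    (LinearMap.snd ℝ _ _) ∘ₗ e.symm.toLinearMap ∘ₗ Ve.toLinearMap ∘ₗ D.toLinearMap ∘ₗ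
      (LinearMap.inl ℝ _ _)
  have hA : ∀ a, A a = (e.symm (Ve (D (a, 0)))).2 := fun _ => rfl
  have hT0 : T 0 = 0 := by
    refine (hDT 0 0).symm.trans ?_
    refine (congrArg (mfderiv IZ IB p z) (map_zero D)).trans ?_
    exact ContinuousLinearMap.map_zero _
  -- The image of `vert` is vertical, and `T` has trivial kernel, so the base component vanishes and
  -- only the group component `A a` survives.
  have h0 : ∀ a, Ve (D (a, 0)) = D (0, A a) := by
    intro a
    obtain ⟨⟨a', b'⟩, hab⟩ := hD.2 (Ve (D (a, 0)))
    have ha' : a' = 0 := by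
      apply hT
      rw [← hDT a' b', hab]
      exact Ω.vert_mem z _
    rw [hA, ← hab, hDe, e.symm_apply_apply, ha']
    rfl
  have hv : ∀ b, Ve (D (0, b)) = D (0, b) := fun b =>
    Ω.vert_of_vertical z _ ((hDT 0 b).trans hT0)
  refine ⟨A, fun a b => ?_, fun a I => ?_⟩
  · change Ve (D (a, b)) = _
    have h1 : ((a, b) : EA × EuclideanSpace ℝ (Fin l)) = (a, 0) + (0, b) := by simp
    rw [h1, map_add, map_add, h0, hv, ← map_add]
    simp [add_comm]
  -- The lift is `D (a, -A a)`; the sign in the definition of the coefficients turns this into `A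
  -- a`.
  · have h1 : (Ω.lift z (T a) : EZ) = D (a, 0) - Ve (D (a, 0)) := Ω.lift_eq (hDT a 0)
    rw [h1, h0, ← map_sub, hℓ]
    simp

end Connections

/-! ### The tangent space of `𝒢` in coordinates and the derivative of the product of `G`. -/

section Charts

set_option linter.unusedSectionVars false

variable {m l n k : ℕ} {M 𝒢 G P : Type*}
  [TopologicalSpace M] [ChartedSpace (EuclideanSpace ℝ (Fin m)) M] [IsManifold (𝓡 m) ∞ M]
  [TopologicalSpace 𝒢] [ChartedSpace (EuclideanSpace ℝ (Fin (m + l))) 𝒢]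
  [Group G] [TopologicalSpace G] [ChartedSpace (EuclideanSpace ℝ (Fin l)) G]
  [LieGroup (𝓡 l) ∞ G]
  [TopologicalSpace P] [ChartedSpace (EuclideanSpace ℝ (Fin (m + n))) P]
  [IsManifold (𝓡 (m + l)) ∞ 𝒢] [IsManifold (𝓡 (m + n)) ∞ P]
  {π : 𝒢 → M} {𝓑 : LieGroupBundle (m := m) (l := l) G π} {πP : P → M}
  {Φ : FiberedAction (n := n) 𝓑 πP}
  [ChartedSpace (EuclideanSpace ℝ (Fin (m + k))) Φ.OrbitSpace]

namespace FiberedAction.Coordinates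

variable (C : Φ.Coordinates (k := k))
  {κ : OpenPartialHomeomorph G (EuclideanSpace ℝ (Fin l))} {g : G}
  {y : EuclideanSpace ℝ (Fin m) × EuclideanSpace ℝ (Fin k)} {x : EuclideanSpace ℝ (Fin m)}

section GroupBundle

variable (hx : x ∈ C.chartM.target)

include hx

theorem hasMFDerivAt_chartM_symm :
    HasMFDerivAt 𝓘(ℝ, EuclideanSpace ℝ (Fin m)) (𝓡 m) C.chartM.symm x
      (mfderiv 𝓘(ℝ, EuclideanSpace ℝ (Fin m)) (𝓡 m) C.chartM.symm x) :=
  ((contMDiffAt_symm_of_mem_maximalAtlas C.chartM_mem hx).mdifferentiableAt (by simp)).hasMFDerivAt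

theorem tangentM_eq_zero {a : EuclideanSpace ℝ (Fin m)} (ha : C.tangentM x a = 0) : a = 0 := by
  have h := mfderiv_apply_of_comp (f := C.chartM.symm) (g := C.chartM) (h := id) rfl
    ((contMDiffAt_of_mem_maximalAtlas C.chartM_mem (C.chartM.map_target hx)).mdifferentiableAt
      (by simp))
    (C.hasMFDerivAt_chartM_symm hx) (hasMFDerivAt_id x)
    (by
      filter_upwards [C.chartM.open_target.mem_nhds hx] with v hv
      exact C.chartM.right_inv hv) a
  refine h.symm.trans ?_
  refine (congrArg _ ha).trans ?_
  exact ContinuousLinearMap.map_zero _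

variable (hκ : κ ∈ IsManifold.maximalAtlas (𝓡 l) ∞ G) (hg : g ∈ κ.source)

include hκ hg

theorem mfderiv_proj_grpTangent (a : EuclideanSpace ℝ (Fin m)) (b : EuclideanSpace ℝ (Fin l)) :
    (mfderiv (𝓡 (m + l)) (𝓡 m) π (C.grpPoint x g) (C.grpTangent κ x g (a, b)) :
      EuclideanSpace ℝ (Fin m)) = C.tangentM x a := by
  have h2 := (C.hasMFDerivAt_chartM_symm hx).comp (x, κ g)
    (hasFDerivAt_fst (𝕜 := ℝ) (p := (x, κ g))).hasMFDerivAt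
  exact mfderiv_apply_of_comp (C.grpChart_apply x hg) (𝓑.smooth_proj.mdifferentiable (by simp) _)
    (C.hasMFDerivAt_grpChart hκ hg hx) h2
    (by
      filter_upwards [(continuous_fst.tendsto (x, κ g)) (C.chartM.open_target.mem_nhds hx)]
        with v hv
      exact C.proj_grpPoint hv _) (a, b)

theorem mdifferentiableAt_snd_triv :
    MDifferentiableAt (𝓡 (m + l)) (𝓡 l) (fun δ => κ (C.triv δ).2) (C.grpPoint x g) := by
  have hmem : C.grpPoint x g ∈ C.triv.source := C.triv.mem_source.2 (by
    rw [C.proj_grpPoint hx]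
    exact C.mem_baseSet hx)
  have h1 : MDifferentiableAt (𝓡 (m + l)) ((𝓡 m).prod (𝓡 l)) C.triv (C.grpPoint x g) :=
    (C.isTriv.1.1.contMDiffAt (C.triv.open_source.mem_nhds hmem)).mdifferentiableAt (by simp)
  have h2 : MDifferentiableAt (𝓡 (m + l)) (𝓡 l) (fun δ => (C.triv δ).2) (C.grpPoint x g) :=
    mdifferentiableAt_snd.comp _ h1
  have h3 : MDifferentiableAt (𝓡 l) (𝓡 l) κ g :=
    (contMDiffAt_of_mem_maximalAtlas hκ hg).mdifferentiableAt (by simp)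
  refine MDifferentiableAt.comp_of_eq (g := κ) (y := g) (C.grpPoint x g) h3 h2 ?_
  rw [C.triv_grpPoint hx]

theorem mfderiv_snd_triv_grpTangent
    (v : EuclideanSpace ℝ (Fin m) × EuclideanSpace ℝ (Fin l)) (I : Fin l) :
    (mfderiv (𝓡 (m + l)) 𝓘(ℝ, ℝ) (fun δ => κ (C.triv δ).2 I) (C.grpPoint x g)
      (C.grpTangent κ x g v) : ℝ) = v.2 I := by
  have hd : MDifferentiableAt (𝓡 (m + l)) 𝓘(ℝ, ℝ) (fun δ => κ (C.triv δ).2 I)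
      (C.grpPoint x g) :=
    ((EuclideanSpace.proj (𝕜 := ℝ) I).differentiableAt.mdifferentiableAt).comp _
      (C.mdifferentiableAt_snd_triv hx hκ hg)
  let L : EuclideanSpace ℝ (Fin m) × EuclideanSpace ℝ (Fin l) →L[ℝ] ℝ :=
    (EuclideanSpace.proj (𝕜 := ℝ) I).comp (ContinuousLinearMap.snd ℝ _ _)
  exact mfderiv_apply_of_comp (h := L) (C.grpChart_apply x hg) hd
    (C.hasMFDerivAt_grpChart hκ hg hx) L.hasFDerivAt.hasMFDerivAt
    (by
      filter_upwards [(C.chartM.open_target.prod κ.open_target).mem_nhds ⟨hx, κ.map_source hg⟩]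
        with u hu
      rw [grpChart, C.triv_grpPoint hu.1, κ.right_inv hu.2]
      rfl) v

/-- Both components can be read off, by `T(π)` and by the differential of the group coordinate. Here
the latter is part of a smooth trivialization, so no inverse function theorem is needed, unlike on
`P`. -/
theorem grpTangent_bijective : Function.Bijective (C.grpTangent κ x g) := by
  have hinj : Function.Injective (C.grpTangent κ x g).toLinearMap := by
    refine (injective_iff_map_eq_zero _).2 fun v hv => ?_
    have hv : C.grpTangent κ x g v = 0 := hv
    have h1 : v.1 = 0 := by
      apply C.tangentM_eq_zero hx
      refine (C.mfderiv_proj_grpTangent hx hκ hg v.1 v.2).symm.trans ?_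
      refine (congrArg _ hv).trans ?_
      exact ContinuousLinearMap.map_zero _
    have h2 : v.2 = 0 := by
      ext I
      refine (C.mfderiv_snd_triv_grpTangent hx hκ hg v I).symm.trans ?_
      refine (congrArg _ hv).trans ?_
      exact ContinuousLinearMap.map_zero _
    exact Prod.ext h1 h2
  refine ⟨hinj, (LinearMap.injective_iff_surjective_of_finrank_eq_finrank ?_).1 hinj⟩
  simp

end GroupBundle

section Action

variable (hy : y ∈ C.chartS.target)
  {κ₁ κ₂ κ₃ : OpenPartialHomeomorph G (EuclideanSpace ℝ (Fin l))} {h : G}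
  (h₁ : κ₁ ∈ IsManifold.maximalAtlas (𝓡 l) ∞ G) (h₂ : κ₂ ∈ IsManifold.maximalAtlas (𝓡 l) ∞ G)
  (h₃ : κ₃ ∈ IsManifold.maximalAtlas (𝓡 l) ∞ G)
  (hg₁ : g ∈ κ₁.source) (hh₂ : h ∈ κ₂.source) (hgh₃ : g * h ∈ κ₃.source)

theorem mfderiv_proj_pointTangent (hy : y ∈ C.chartS.target)
    (hκ : κ ∈ IsManifold.maximalAtlas (𝓡 l) ∞ G) (hg : g ∈ κ.source)
    (hP : MDifferentiable (𝓡 (m + n)) (𝓡 m) πP)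
    (a : EuclideanSpace ℝ (Fin m) × EuclideanSpace ℝ (Fin k)) (b : EuclideanSpace ℝ (Fin l)) :
    (mfderiv (𝓡 (m + n)) (𝓡 m) πP (C.point y g) (C.pointTangent κ y g (a, b)) :
      EuclideanSpace ℝ (Fin m)) = C.tangentM y.1 a.1 := by
  have h2 := (C.hasMFDerivAt_chartM_symm (C.fst_mem_target hy)).comp (y, κ g)
    ((hasFDerivAt_fst (𝕜 := ℝ) (p := y)).comp (y, κ g)
      (hasFDerivAt_fst (𝕜 := ℝ) (p := (y, κ g)))).hasMFDerivAt
  exact mfderiv_apply_of_comp (C.pointChart_apply y hg) (hP _)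
    (C.hasMFDerivAt_pointChart hy hκ hg) h2
    (by
      filter_upwards [(continuous_fst.tendsto (y, κ g)) (C.chartS.open_target.mem_nhds hy)]
        with v hv
      exact C.proj_point hv _) (a, b)

/-- The tangent map of the multiplication of `G` in charts. -/
def mulDeriv (κ₁ κ₂ κ₃ : OpenPartialHomeomorph G (EuclideanSpace ℝ (Fin l))) (g h : G) :
    EuclideanSpace ℝ (Fin l) × EuclideanSpace ℝ (Fin l) →L[ℝ] EuclideanSpace ℝ (Fin l) :=
  fderiv ℝ (fun v : EuclideanSpace ℝ (Fin l) × EuclideanSpace ℝ (Fin l) =>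
    κ₃ (κ₁.symm v.1 * κ₂.symm v.2)) (κ₁ g, κ₂ h)

include h₁ h₂ h₃ hg₁ hh₂ hgh₃

theorem hasFDerivAt_mul :
    HasFDerivAt (fun v : EuclideanSpace ℝ (Fin l) × EuclideanSpace ℝ (Fin l) =>
      κ₃ (κ₁.symm v.1 * κ₂.symm v.2)) (mulDeriv κ₁ κ₂ κ₃ g h) (κ₁ g, κ₂ h) := by
  have := contDiffAt_mul_of_mem_maximalAtlas h₁ h₂ h₃ (κ₁.map_source hg₁) (κ₂.map_source hh₂) 1
    (by rwa [mul_one, κ₁.left_inv hg₁, κ₂.left_inv hh₂])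
  simp only [mul_one] at this
  exact (this.differentiableAt (by simp)).hasFDerivAt

theorem eventually_mul_mem :
    ∀ᶠ v : EuclideanSpace ℝ (Fin l) × EuclideanSpace ℝ (Fin l) in 𝓝 (κ₁ g, κ₂ h),
      κ₁.symm v.1 * κ₂.symm v.2 ∈ κ₃.source := by
  have : ContinuousMul G := continuousMul_of_contMDiffMul (𝓡 l) ∞
  have c1 : ContinuousAt (fun v : EuclideanSpace ℝ (Fin l) × EuclideanSpace ℝ (Fin l) =>
      κ₁.symm v.1) (κ₁ g, κ₂ h) :=
    ContinuousAt.comp (g := κ₁.symm) (f := Prod.fst) (x := (κ₁ g, κ₂ h))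
      (κ₁.continuousAt_symm (κ₁.map_source hg₁)) continuousAt_fst
  have c2 : ContinuousAt (fun v : EuclideanSpace ℝ (Fin l) × EuclideanSpace ℝ (Fin l) =>
      κ₂.symm v.2) (κ₁ g, κ₂ h) :=
    ContinuousAt.comp (g := κ₂.symm) (f := Prod.snd) (x := (κ₁ g, κ₂ h))
      (κ₂.continuousAt_symm (κ₂.map_source hh₂)) continuousAt_snd
  apply (c1.mul c2)
  apply κ₃.open_source.mem_nhds
  change κ₁.symm (κ₁ g) * κ₂.symm (κ₂ h) ∈ _
  rwa [κ₁.left_inv hg₁, κ₂.left_inv hh₂]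

/-- Links the total derivative, in which the action is computed, to the partial derivatives of the
conditions: restrict to one factor and expand in the standard basis. -/
theorem mulDeriv_left (a : EuclideanSpace ℝ (Fin l)) (I : Fin l) :
    mulDeriv κ₁ κ₂ κ₃ g h (a, 0) I = ∑ A, a A * partialMulLeft κ₁ κ₃ g h A I := by
  have h1 := (hasFDerivAt_mul h₁ h₂ h₃ hg₁ hh₂ hgh₃).comp (κ₁ g)
    (hasFDerivAt_prodMk_left (𝕜 := ℝ) (κ₁ g) (κ₂ h))
  have h2 := (EuclideanSpace.proj (𝕜 := ℝ) I).hasFDerivAt.comp (κ₁ g) h1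
  have h3 : ∀ A, partialMulLeft κ₁ κ₃ g h A I =
      mulDeriv κ₁ κ₂ κ₃ g h (EuclideanSpace.single A 1, 0) I := by
    intro A
    rw [partialMulLeft]
    have := h2.fderiv
    simp only [Function.comp_def, κ₂.left_inv hh₂] at this
    exact DFunLike.congr_fun this (EuclideanSpace.single A 1)
  simp only [h3]
  conv_lhs => rw [← (EuclideanSpace.basisFun (Fin l) ℝ).sum_repr a]
  have h4 : ((∑ A, (EuclideanSpace.basisFun (Fin l) ℝ).repr a A •
      EuclideanSpace.basisFun (Fin l) ℝ A, 0) : EuclideanSpace ℝ (Fin l) × EuclideanSpace ℝ (Fin l))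
      = ∑ A, a A • (EuclideanSpace.single A 1, 0) := by
    refine Prod.ext ?_ ?_ <;> simp [Prod.fst_sum, Prod.snd_sum]
  rw [h4, map_sum]
  simp [-Prod.smul_mk]

theorem mulDeriv_right (a : EuclideanSpace ℝ (Fin l)) (I : Fin l) :
    mulDeriv κ₁ κ₂ κ₃ g h (0, a) I = ∑ A, a A * partialMulRight κ₂ κ₃ g h A I := by
  have h1 := (hasFDerivAt_mul h₁ h₂ h₃ hg₁ hh₂ hgh₃).comp (κ₂ h)
    (hasFDerivAt_prodMk_right (𝕜 := ℝ) (κ₁ g) (κ₂ h))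
  have h2 := (EuclideanSpace.proj (𝕜 := ℝ) I).hasFDerivAt.comp (κ₂ h) h1
  have h3 : ∀ A, partialMulRight κ₂ κ₃ g h A I =
      mulDeriv κ₁ κ₂ κ₃ g h (0, EuclideanSpace.single A 1) I := by
    intro A
    rw [partialMulRight]
    have := h2.fderiv
    simp only [Function.comp_def, κ₁.left_inv hg₁] at this
    exact DFunLike.congr_fun this (EuclideanSpace.single A 1)
  simp only [h3]
  conv_lhs => rw [← (EuclideanSpace.basisFun (Fin l) ℝ).sum_repr a]
  have h4 : ((0, ∑ A, (EuclideanSpace.basisFun (Fin l) ℝ).repr a A •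
      EuclideanSpace.basisFun (Fin l) ℝ A) : EuclideanSpace ℝ (Fin l) × EuclideanSpace ℝ (Fin l))
      = ∑ A, a A • (0, EuclideanSpace.single A 1) := by
    refine Prod.ext ?_ ?_ <;> simp [Prod.fst_sum, Prod.snd_sum]
  rw [h4, map_sum]
  simp [-Prod.smul_mk]

end Action

end FiberedAction.Coordinates

end Charts

/-! ### The three tangent maps of the defining equation in coordinates. -/

section Charts

set_option linter.unusedSectionVars false

variable {m l n k : ℕ} {M 𝒢 G P : Type*}
  [TopologicalSpace M] [ChartedSpace (EuclideanSpace ℝ (Fin m)) M] [IsManifold (𝓡 m) ∞ M]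
  [TopologicalSpace 𝒢] [ChartedSpace (EuclideanSpace ℝ (Fin (m + l))) 𝒢]
  [Group G] [TopologicalSpace G] [ChartedSpace (EuclideanSpace ℝ (Fin l)) G]
  [LieGroup (𝓡 l) ∞ G]
  [TopologicalSpace P] [ChartedSpace (EuclideanSpace ℝ (Fin (m + n))) P]
  [IsManifold (𝓡 (m + l)) ∞ 𝒢] [IsManifold (𝓡 (m + n)) ∞ P]
  {π : 𝒢 → M} {𝓑 : LieGroupBundle (m := m) (l := l) G π} {πP : P → M}
  {Φ : FiberedAction (n := n) 𝓑 πP}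
  [ChartedSpace (EuclideanSpace ℝ (Fin (m + k))) Φ.OrbitSpace]

namespace FiberedAction.Coordinates

variable (C : Φ.Coordinates (k := k))
  {κ : OpenPartialHomeomorph G (EuclideanSpace ℝ (Fin l))} {g : G}
  {y : EuclideanSpace ℝ (Fin m) × EuclideanSpace ℝ (Fin k)} {x : EuclideanSpace ℝ (Fin m)}

/-- `𝓑.mul γ` is meaningful only on one fibre. There it agrees with the map that multiplies the
group coordinate and keeps `x` fixed, which is differentiable at the point without restriction to
the fibre. -/
theorem mdifferentiableWithinAt_mul (hx : x ∈ C.chartM.target) (h : G) {γ : 𝒢}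
    (hγ : π γ = C.chartM.symm x) :
    MDifferentiableWithinAt (𝓡 (m + l)) (𝓡 (m + l)) (fun ε => 𝓑.mul γ ε)
      (π ⁻¹' {π (C.grpPoint x h)}) (C.grpPoint x h) := by
  obtain ⟨g, rfl⟩ := C.exists_grpPoint hx hγ
  have hmem : C.grpPoint x h ∈ C.triv.source := C.triv.mem_source.2 (by
    rw [C.proj_grpPoint hx]
    exact C.mem_baseSet hx)
  have h1 : MDifferentiableAt (𝓡 (m + l)) ((𝓡 m).prod (𝓡 l)) C.triv (C.grpPoint x h) :=
    (C.isTriv.1.1.contMDiffAt (C.triv.open_source.mem_nhds hmem)).mdifferentiableAt (by simp)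
  have h2 : MDifferentiableAt (𝓡 (m + l)) (𝓡 l) (fun δ => (C.triv δ).2) (C.grpPoint x h) :=
    mdifferentiableAt_snd.comp _ h1
  have hL : MDifferentiable (𝓡 l) (𝓡 l) (fun b : G => g * b) :=
    (contMDiff_mul_left (I := 𝓡 l) (n := ∞) (a := g)).mdifferentiable (by simp)
  have h3 : MDifferentiableAt (𝓡 (m + l)) (𝓡 l) (fun δ => g * (C.triv δ).2) (C.grpPoint x h) :=
    (hL _).comp (C.grpPoint x h) h2
  have h4 : ∀ b : G, MDifferentiableAt ((𝓡 m).prod (𝓡 l)) (𝓡 (m + l))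
      C.triv.toOpenPartialHomeomorph.symm (C.chartM.symm x, b) := fun b =>
    (C.isTriv.1.2.contMDiffAt (C.triv.open_target.mem_nhds
      (C.triv.mem_target.2 (C.mem_baseSet hx)))).mdifferentiableAt (by simp)
  have h5 : MDifferentiableAt (𝓡 (m + l)) (𝓡 (m + l))
      (fun δ => C.grpPoint x (g * (C.triv δ).2)) (C.grpPoint x h) :=
    (h4 _).comp (f := fun δ => (C.chartM.symm x, g * (C.triv δ).2)) (C.grpPoint x h)
      (mdifferentiableAt_const.prodMk h3)
  have heq : ∀ ε ∈ π ⁻¹' {π (C.grpPoint x h)},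
      𝓑.mul (C.grpPoint x g) ε = C.grpPoint x (g * (C.triv ε).2) := by
    intro ε hε
    obtain ⟨b, rfl⟩ := C.exists_grpPoint hx (hε.trans (C.proj_grpPoint hx h))
    rw [C.triv_grpPoint hx, C.mul_grpPoint hx]
  exact h5.mdifferentiableWithinAt.congr heq (heq _ rfl)

variable (hy : y ∈ C.chartS.target)
  {κ₁ κ₂ κ₃ : OpenPartialHomeomorph G (EuclideanSpace ℝ (Fin l))} {h : G}
  (h₁ : κ₁ ∈ IsManifold.maximalAtlas (𝓡 l) ∞ G) (h₂ : κ₂ ∈ IsManifold.maximalAtlas (𝓡 l) ∞ G)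
  (h₃ : κ₃ ∈ IsManifold.maximalAtlas (𝓡 l) ∞ G)
  (hg₁ : g ∈ κ₁.source) (hh₂ : h ∈ κ₂.source) (hgh₃ : g * h ∈ κ₃.source)

include hy h₁ h₂ h₃ hg₁ hh₂ hgh₃

/-- The tangent map of the action in coordinates. -/
theorem hasMFDerivAt_point_mul :
    HasMFDerivAt 𝓘(ℝ, ((EuclideanSpace ℝ (Fin m) × EuclideanSpace ℝ (Fin k)) ×
        EuclideanSpace ℝ (Fin l)) × EuclideanSpace ℝ (Fin l)) (𝓡 (m + n))
      (fun v : ((EuclideanSpace ℝ (Fin m) × EuclideanSpace ℝ (Fin k)) ×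
        EuclideanSpace ℝ (Fin l)) × EuclideanSpace ℝ (Fin l) =>
        C.point v.1.1 (κ₁.symm v.1.2 * κ₂.symm v.2)) ((y, κ₁ g), κ₂ h)
      ((C.pointTangent κ₃ y (g * h)).comp
        (((ContinuousLinearMap.fst ℝ _ _).comp (ContinuousLinearMap.fst ℝ _ _)).prod
          ((mulDeriv κ₁ κ₂ κ₃ g h).comp
            (((ContinuousLinearMap.snd ℝ _ _).comp (ContinuousLinearMap.fst ℝ _ _)).prod
              (ContinuousLinearMap.snd ℝ _ _))))) := by
  set L₀ : ((EuclideanSpace ℝ (Fin m) × EuclideanSpace ℝ (Fin k)) × EuclideanSpace ℝ (Fin l)) ×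
      EuclideanSpace ℝ (Fin l) →L[ℝ] EuclideanSpace ℝ (Fin m) × EuclideanSpace ℝ (Fin k) :=
    (ContinuousLinearMap.fst ℝ _ _).comp (ContinuousLinearMap.fst ℝ _ _) with hL₀
  set L : ((EuclideanSpace ℝ (Fin m) × EuclideanSpace ℝ (Fin k)) × EuclideanSpace ℝ (Fin l)) ×
      EuclideanSpace ℝ (Fin l) →L[ℝ] EuclideanSpace ℝ (Fin l) × EuclideanSpace ℝ (Fin l) :=
    ((ContinuousLinearMap.snd ℝ _ _).comp (ContinuousLinearMap.fst ℝ _ _)).prod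
      (ContinuousLinearMap.snd ℝ _ _) with hL
  have d1 := (hasFDerivAt_mul h₁ h₂ h₃ hg₁ hh₂ hgh₃).comp (f := L) ((y, κ₁ g), κ₂ h) L.hasFDerivAt
  have d2 := L₀.hasFDerivAt.prodMk d1
  have d3 := C.hasMFDerivAt_pointChart hy h₃ hgh₃
  have hval : (L₀ ((y, κ₁ g), κ₂ h), κ₃ (κ₁.symm (L ((y, κ₁ g), κ₂ h)).1 *
      κ₂.symm (L ((y, κ₁ g), κ₂ h)).2)) = (y, κ₃ (g * h)) := by
    change (y, κ₃ (κ₁.symm (κ₁ g) * κ₂.symm (κ₂ h))) = _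
    rw [κ₁.left_inv hg₁, κ₂.left_inv hh₂]
  rw [← hval] at d3
  refine (d3.comp ((y, κ₁ g), κ₂ h) d2.hasMFDerivAt).congr_of_eventuallyEq ?_
  have hev := eventually_mul_mem h₁ h₂ h₃ hg₁ hh₂ hgh₃
  filter_upwards [(L.continuous.tendsto ((y, κ₁ g), κ₂ h)).eventually hev] with v hv
  change _ = C.point v.1.1 (κ₃.symm (κ₃ (κ₁.symm v.1.2 * κ₂.symm v.2)))
  rw [κ₃.left_inv (show κ₁.symm v.1.2 * κ₂.symm v.2 ∈ κ₃.source from hv)]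

/-- The fibered product is parametrized by the coordinates of `P` and one more group coordinate, the
base coordinate being shared. In this parametrization the action multiplies group coordinates. -/
theorem tangentMap_point (a : EuclideanSpace ℝ (Fin m) × EuclideanSpace ℝ (Fin k))
    (b b' : EuclideanSpace ℝ (Fin l)) :
    (Φ.tangentMap (C.point y g) (C.grpPoint y.1 h) (C.pointTangent κ₁ y g (a, b))
      (C.grpTangent κ₂ y.1 h (a.1, b')) : EuclideanSpace ℝ (Fin (m + n))) =
      C.pointTangent κ₃ y (g * h) (a, mulDeriv κ₁ κ₂ κ₃ g h (b, b')) := by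
  have hx := C.fst_mem_target hy
  let L : ((EuclideanSpace ℝ (Fin m) × EuclideanSpace ℝ (Fin k)) × EuclideanSpace ℝ (Fin l)) ×
      EuclideanSpace ℝ (Fin l) →L[ℝ] EuclideanSpace ℝ (Fin m) × EuclideanSpace ℝ (Fin l) :=
    ((ContinuousLinearMap.fst ℝ _ _).comp ((ContinuousLinearMap.fst ℝ _ _).comp
      (ContinuousLinearMap.fst ℝ _ _))).prod (ContinuousLinearMap.snd ℝ _ _)
  have f1 := (C.hasMFDerivAt_pointChart hy h₁ hg₁).comp ((y, κ₁ g), κ₂ h)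
    (hasFDerivAt_fst (𝕜 := ℝ) (p := ((y, κ₁ g), κ₂ h))).hasMFDerivAt
  have f2 := (C.hasMFDerivAt_grpChart h₂ hh₂ hx).comp (f := L) ((y, κ₁ g), κ₂ h)
    L.hasFDerivAt.hasMFDerivAt
  refine mfderivWithin_apply_of_comp
    (Prod.ext (C.pointChart_apply y hg₁) (C.grpChart_apply y.1 hh₂))
    (Φ.mdifferentiableWithinAt_act
      ((C.proj_point hy g).trans (C.proj_grpPoint hx h).symm)) (f1.prodMk f2) ?_
    (C.hasMFDerivAt_point_mul hy h₁ h₂ h₃ hg₁ hh₂ hgh₃) ?_ ((a, b), b')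
  all_goals
    filter_upwards [((continuous_fst.comp continuous_fst).tendsto ((y, κ₁ g), κ₂ h))
      (C.chartS.open_target.mem_nhds hy)] with v hv
  · exact (C.proj_point hv _).trans (C.proj_grpPoint (C.fst_mem_target hv) _).symm
  · exact C.act_point hv _ _

theorem tangentR_point (b : EuclideanSpace ℝ (Fin l)) :
    (Φ.tangentR (C.point y g) (C.grpPoint y.1 h) (C.pointTangent κ₁ y g (0, b)) :
      EuclideanSpace ℝ (Fin (m + n))) =
      C.pointTangent κ₃ y (g * h) (0, mulDeriv κ₁ κ₂ κ₃ g h (b, 0)) := by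
  have hx := C.fst_mem_target hy
  have f1 := (C.hasMFDerivAt_pointChart hy h₁ hg₁).comp (κ₁ g)
    (hasFDerivAt_prodMk_right (𝕜 := ℝ) y (κ₁ g)).hasMFDerivAt
  have f2 := (C.hasMFDerivAt_point_mul hy h₁ h₂ h₃ hg₁ hh₂ hgh₃).comp (κ₁ g)
    ((hasFDerivAt_prodMk_left (𝕜 := ℝ) (y, κ₁ g) (κ₂ h)).comp (κ₁ g)
      (hasFDerivAt_prodMk_right (𝕜 := ℝ) y (κ₁ g))).hasMFDerivAt
  refine mfderivWithin_apply_of_comp (f := C.pointChart κ₁ ∘ Prod.mk y)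
    (C.pointChart_apply y hg₁) (Φ.mdifferentiableWithinAt_act_left
      ((C.proj_point hy g).trans (C.proj_grpPoint hx h).symm)) f1
    (Filter.Eventually.of_forall fun u => ?_) f2 (Filter.Eventually.of_forall fun u => ?_) b
  · exact (C.proj_point hy _).trans (C.proj_point hy _).symm
  · change Φ.act (C.point y (κ₁.symm u), C.grpPoint y.1 h) =
      C.point y (κ₁.symm u * κ₂.symm (κ₂ h))
    rw [κ₂.left_inv hh₂, C.act_point hy]

/-- The left side differentiates `δ ↦ Φ(Φ(p, γ), γ⁻¹ δ)` at `δ = γ`, and this map equals `δ ↦ Φ(p,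
δ)`; the inverse disappears and the second partial derivative of the product remains. -/
theorem fundamental_point (b : EuclideanSpace ℝ (Fin l)) :
    (Φ.fundamental (Φ.act (C.point y g, C.grpPoint y.1 h))
      (𝓑.tangentL (𝓑.inv (C.grpPoint y.1 h)) (C.grpPoint y.1 h) (C.grpTangent κ₂ y.1 h (0, b))) :
      EuclideanSpace ℝ (Fin (m + n))) =
      C.pointTangent κ₃ y (g * h) (0, mulDeriv κ₁ κ₂ κ₃ g h (0, b)) := by
  have hx := C.fst_mem_target hy
  have hinv : π (𝓑.inv (C.grpPoint y.1 h)) = C.chartM.symm y.1 :=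
    (𝓑.proj_inv _).trans (C.proj_grpPoint hx h)
  have f1 := (C.hasMFDerivAt_grpChart h₂ hh₂ hx).comp (κ₂ h)
    (hasFDerivAt_prodMk_right (𝕜 := ℝ) y.1 (κ₂ h)).hasMFDerivAt
  have hq : πP (C.point y g) = π (C.grpPoint y.1 h) :=
    (C.proj_point hy g).trans (C.proj_grpPoint hx h).symm
  have hone : 𝓑.mul (𝓑.inv (C.grpPoint y.1 h)) (C.grpPoint y.1 h) =
      𝓑.one (πP (Φ.act (C.point y g, C.grpPoint y.1 h))) := by
    rw [𝓑.inv_mul, Φ.proj_act _ _ hq, hq]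
  have hpt : C.grpPoint y.1 (κ₂.symm (κ₂ h)) = C.grpPoint y.1 h := by rw [κ₂.left_inv hh₂]
  have f2 : HasMFDerivAt (𝓡 l) (𝓡 (m + l))
      (fun w => 𝓑.mul (𝓑.inv (C.grpPoint y.1 h)) (C.grpPoint y.1 (κ₂.symm w))) (κ₂ h)
      ((show EuclideanSpace ℝ (Fin (m + l)) →L[ℝ] EuclideanSpace ℝ (Fin (m + l)) from
        𝓑.tangentL (𝓑.inv (C.grpPoint y.1 h)) (C.grpPoint y.1 h)).comp
        ((C.grpTangent κ₂ y.1 h).comp (ContinuousLinearMap.inr ℝ _ _))) := by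
    exact hasMFDerivAt_comp_of_mdifferentiableWithinAt (f := C.grpChart κ₂ ∘ Prod.mk y.1) hpt
      (C.mdifferentiableWithinAt_mul hx h hinv) f1 (Filter.Eventually.of_forall fun w =>
        (C.proj_grpPoint hx _).trans (C.proj_grpPoint hx _).symm)
  have f3 := (C.hasMFDerivAt_point_mul hy h₁ h₂ h₃ hg₁ hh₂ hgh₃).comp (κ₂ h)
    (hasFDerivAt_prodMk_right (𝕜 := ℝ) (y, κ₁ g) (κ₂ h)).hasMFDerivAt
  refine mfderivWithin_apply_of_comp (x := 𝓑.one (πP (Φ.act (C.point y g, C.grpPoint y.1 h))))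
    ?_ (Φ.mdifferentiableWithinAt_act_right (𝓑.proj_one _).symm) f2
    (Filter.Eventually.of_forall fun w => ?_) f3 (Filter.Eventually.of_forall fun w => ?_) b
  · rw [hpt, hone]
  · change π _ = πP _
    rw [𝓑.proj_mul _ _ (hinv.trans (C.proj_grpPoint hx _).symm), hinv, Φ.proj_act _ _ hq,
      C.proj_point hy]
  · change Φ.act (Φ.act (C.point y g, C.grpPoint y.1 h), _) =
      C.point y (κ₁.symm (κ₁ g) * κ₂.symm w)
    obtain ⟨h', hh'⟩ := C.exists_grpPoint hx hinv
    -- The trivialization is only assumed multiplicative. Cancelling in `γ (γ γ⁻¹) = γ` avoids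
    -- computing the group coordinate of the unit.
    have h1 : h * h' = 1 := by
      have e1 := 𝓑.mul_inv (C.grpPoint y.1 h)
      have e2 := 𝓑.mul_one (C.grpPoint y.1 h)
      rw [← e1, hh', C.mul_grpPoint hx, C.mul_grpPoint hx] at e2
      have e3 := congrArg C.triv e2
      rw [C.triv_grpPoint hx, C.triv_grpPoint hx] at e3
      simpa using (Prod.ext_iff.1 e3).2
    rw [κ₁.left_inv hg₁, hh', C.mul_grpPoint hx, C.act_point hy, C.act_point hy, mul_assoc,
      ← mul_assoc h, h1, one_mul]

end FiberedAction.Coordinates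

end Charts

/-! ### The defining equation at a pair `(p, γ)` is equivalent to the identities for the
coefficients. -/

section Charts

set_option linter.unusedSectionVars false

variable {m l n k : ℕ} {M 𝒢 G P : Type*}
  [TopologicalSpace M] [ChartedSpace (EuclideanSpace ℝ (Fin m)) M] [IsManifold (𝓡 m) ∞ M]
  [TopologicalSpace 𝒢] [ChartedSpace (EuclideanSpace ℝ (Fin (m + l))) 𝒢]
  [Group G] [TopologicalSpace G] [ChartedSpace (EuclideanSpace ℝ (Fin l)) G]
  [LieGroup (𝓡 l) ∞ G]
  [TopologicalSpace P] [ChartedSpace (EuclideanSpace ℝ (Fin (m + n))) P]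
  [IsManifold (𝓡 (m + l)) ∞ 𝒢] [IsManifold (𝓡 (m + n)) ∞ P]
  {π : 𝒢 → M} {𝓑 : LieGroupBundle (m := m) (l := l) G π} {πP : P → M}
  {Φ : FiberedAction (n := n) 𝓑 πP}
  [ChartedSpace (EuclideanSpace ℝ (Fin (m + k))) Φ.OrbitSpace]

namespace FiberedAction.Coordinates

variable (C : Φ.Coordinates (k := k)) {g h : G}
  {y : EuclideanSpace ℝ (Fin m) × EuclideanSpace ℝ (Fin k)}

/-- The local form of a connection on `P → P/𝒢`. -/
theorem exists_coeff (hfree : Φ.IsFree)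
    (hS : IsSmoothFiberBundle (𝓡 (m + k)) (𝓡 l) (𝓡 (m + n)) G Φ.toOrbit)
    (Ω : Connection (𝓡 (m + k)) (𝓡 (m + n)) Φ.toOrbit) (hy : y ∈ C.chartS.target)
    {κ : OpenPartialHomeomorph G (EuclideanSpace ℝ (Fin l))}
    (hκ : κ ∈ IsManifold.maximalAtlas (𝓡 l) ∞ G) (hg : g ∈ κ.source) :
    ∃ A : EuclideanSpace ℝ (Fin m) × EuclideanSpace ℝ (Fin k) →ₗ[ℝ] EuclideanSpace ℝ (Fin l),
      (∀ a b, (Ω.vert (C.point y g) (C.pointTangent κ y g (a, b)) : EuclideanSpace ℝ (Fin (m + n)))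
        = C.pointTangent κ y g (0, b + A a)) ∧
      ∀ a I, C.coeff Ω κ y g a I = A a I :=
  Ω.exists_coeff (z := C.point y g) (C.pointTangent_bijective hy hκ hg hfree hS)
    (T := fun a => C.tangentS y a) (fun _ => C.tangentS_eq_zero hy)
    (C.mfderiv_toOrbit_pointTangent hy hκ hg (hS.1.mdifferentiable (by simp)))
    (ℓ := fun I => mfderiv (𝓡 (m + n)) 𝓘(ℝ, ℝ) (fun q => κ (C.grpCoord q) I) (C.point y g))
    (fun I v => C.mfderiv_grpCoord_pointTangent hy hκ hg hfree hS v I)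

/-- The local form of a connection on `𝒢 → M`. -/
theorem exists_grpCoeff (η : Connection (𝓡 m) (𝓡 (m + l)) π) {x : EuclideanSpace ℝ (Fin m)}
    (hx : x ∈ C.chartM.target)
    {κ : OpenPartialHomeomorph G (EuclideanSpace ℝ (Fin l))}
    (hκ : κ ∈ IsManifold.maximalAtlas (𝓡 l) ∞ G) (hh : h ∈ κ.source) :
    ∃ A : EuclideanSpace ℝ (Fin m) →ₗ[ℝ] EuclideanSpace ℝ (Fin l),
      (∀ a b, (η.vert (C.grpPoint x h) (C.grpTangent κ x h (a, b)) :
        EuclideanSpace ℝ (Fin (m + l))) = C.grpTangent κ x h (0, b + A a)) ∧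
      ∀ I μ, C.grpCoeff η κ x h I μ = A (EuclideanSpace.single μ 1) I := by
  obtain ⟨A, h1, h2⟩ := η.exists_coeff (z := C.grpPoint x h) (C.grpTangent_bijective hx hκ hh)
    (T := fun a => C.tangentM x a) (fun _ => C.tangentM_eq_zero hx)
    (C.mfderiv_proj_grpTangent hx hκ hh)
    (ℓ := fun I => mfderiv (𝓡 (m + l)) 𝓘(ℝ, ℝ) (fun δ => κ (C.triv δ).2 I) (C.grpPoint x h))
    (fun I v => C.mfderiv_snd_triv_grpTangent hx hκ hh v I)
  exact ⟨A, h1, fun I μ => h2 _ I⟩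

variable (hfree : Φ.IsFree)
  (hP : MDifferentiable (𝓡 (m + n)) (𝓡 m) πP)
  (hS : IsSmoothFiberBundle (𝓡 (m + k)) (𝓡 l) (𝓡 (m + n)) G Φ.toOrbit)
  (Ω : Connection (𝓡 (m + k)) (𝓡 (m + n)) Φ.toOrbit) (η : Connection (𝓡 m) (𝓡 (m + l)) π)
  (hy : y ∈ C.chartS.target)
  {κ₁ κ₂ κ₃ : OpenPartialHomeomorph G (EuclideanSpace ℝ (Fin l))}
  (h₁ : κ₁ ∈ IsManifold.maximalAtlas (𝓡 l) ∞ G) (h₂ : κ₂ ∈ IsManifold.maximalAtlas (𝓡 l) ∞ G)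
  (h₃ : κ₃ ∈ IsManifold.maximalAtlas (𝓡 l) ∞ G)
  (hg₁ : g ∈ κ₁.source) (hh₂ : h ∈ κ₂.source) (hgh₃ : g * h ∈ κ₃.source)

include hfree hP hS hy h₁ h₂ h₃ hg₁ hh₂ hgh₃

/-- The identities for the coefficients at a point are the coordinate expression of the equation
defining generalized principal connections. -/
theorem coeffIdentities_iff :
    C.CoeffIdentities Ω η κ₁ κ₂ κ₃ y g h ↔
      ∀ (z : TangentSpace (𝓡 (m + n)) (C.point y g))
        (v : TangentSpace (𝓡 (m + l)) (C.grpPoint y.1 h)),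
        (mfderiv (𝓡 (m + n)) (𝓡 m) πP (C.point y g) z : EuclideanSpace ℝ (Fin m)) =
          mfderiv (𝓡 (m + l)) (𝓡 m) π (C.grpPoint y.1 h) v →
        Ω.vert (Φ.act (C.point y g, C.grpPoint y.1 h))
            (Φ.tangentMap (C.point y g) (C.grpPoint y.1 h) z v) =
          Φ.tangentR (C.point y g) (C.grpPoint y.1 h) (Ω.vert (C.point y g) z) +
            Φ.fundamental (Φ.act (C.point y g, C.grpPoint y.1 h))
              (𝓑.tangentL (𝓑.inv (C.grpPoint y.1 h)) (C.grpPoint y.1 h)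
                (η.vert (C.grpPoint y.1 h) v)) := by
  have hx := C.fst_mem_target hy
  obtain ⟨A₁, hA₁, hc₁⟩ := C.exists_coeff hfree hS Ω hy h₁ hg₁
  obtain ⟨A₃, hA₃, hc₃⟩ := C.exists_coeff hfree hS Ω hy h₃ hgh₃
  obtain ⟨N, hN, hcN⟩ := C.exists_grpCoeff η hx h₂ hh₂
  have hA₃' : ∀ a b, (Ω.vert (Φ.act (C.point y g, C.grpPoint y.1 h))
      (C.pointTangent κ₃ y (g * h) (a, b)) : EuclideanSpace ℝ (Fin (m + n))) =
      C.pointTangent κ₃ y (g * h) (0, b + A₃ a) := by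
    rw [C.act_point hy]
    exact hA₃
  set m' := mulDeriv κ₁ κ₂ κ₃ g h with hm'
  have hsplit : ∀ u w, m' (u, w) = m' (u, 0) + m' (0, w) := by
    intro u w
    rw [← map_add]
    simp
  -- The two families of identities are one equality of linear maps, tested on the vectors `∂_μ` and
  -- `∂_Θ`; on the latter the term of `η` is `N 0 = 0`.
  have hloc : C.CoeffIdentities Ω η κ₁ κ₂ κ₃ y g h ↔
      A₃ = m'.toLinearMap ∘ₗ (A₁.prod (N ∘ₗ LinearMap.fst ℝ _ _)) := by
    simp only [CoeffIdentities, coeffBase, coeffFiber, hc₁, hc₃, hcN,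
      ← mulDeriv_left h₁ h₂ h₃ hg₁ hh₂ hgh₃, ← mulDeriv_right h₁ h₂ h₃ hg₁ hh₂ hgh₃]
    constructor
    · rintro ⟨e1, e2⟩
      refine LinearMap.prod_ext ?_ ?_
      · refine (EuclideanSpace.basisFun (Fin m) ℝ).toBasis.ext fun μ => ?_
        ext I
        have := e1 I μ
        simp only [OrthonormalBasis.coe_toBasis, EuclideanSpace.basisFun_apply]
        change A₃ (EuclideanSpace.single μ 1, 0) I =
          m' (A₁ (EuclideanSpace.single μ 1, 0), N (EuclideanSpace.single μ 1)) I
        rw [hsplit, this]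
        rfl
      · refine (EuclideanSpace.basisFun (Fin k) ℝ).toBasis.ext fun Θ => ?_
        ext I
        have := e2 I Θ
        simp only [OrthonormalBasis.coe_toBasis, EuclideanSpace.basisFun_apply]
        change A₃ (0, EuclideanSpace.single Θ 1) I =
          m' (A₁ (0, EuclideanSpace.single Θ 1), N 0) I
        rw [map_zero, this]
    · rintro rfl
      refine ⟨fun I μ => ?_, fun I Θ => ?_⟩
      · change m' (A₁ (EuclideanSpace.single μ 1, 0), N (EuclideanSpace.single μ 1)) I = _
        rw [hsplit]
        rfl
      · change m' (A₁ (0, EuclideanSpace.single Θ 1), N 0) I = _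
        rw [map_zero]
  have hb₁ := C.pointTangent_bijective hy h₁ hg₁ hfree hS
  have hb₃ := C.pointTangent_bijective hy h₃ hgh₃ hfree hS
  have hbN := C.grpTangent_bijective hx h₂ hh₂
  -- Every compatible pair of tangent vectors has this form. The group components `b` and `b'` enter
  -- both sides through `m'` and cancel, so the condition involves `a` alone.
  have hterm : ∀ a b b',
      (Ω.vert (Φ.act (C.point y g, C.grpPoint y.1 h))
            (Φ.tangentMap (C.point y g) (C.grpPoint y.1 h) (C.pointTangent κ₁ y g (a, b))
              (C.grpTangent κ₂ y.1 h (a.1, b'))) =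
          Φ.tangentR (C.point y g) (C.grpPoint y.1 h)
            (Ω.vert (C.point y g) (C.pointTangent κ₁ y g (a, b))) +
            Φ.fundamental (Φ.act (C.point y g, C.grpPoint y.1 h))
              (𝓑.tangentL (𝓑.inv (C.grpPoint y.1 h)) (C.grpPoint y.1 h)
                (η.vert (C.grpPoint y.1 h) (C.grpTangent κ₂ y.1 h (a.1, b'))))) ↔
        A₃ a = m' (A₁ a, N a.1) := by
    intro a b b'
    have e1 := C.tangentMap_point hy h₁ h₂ h₃ hg₁ hh₂ hgh₃ a b b'
    have e2 := C.tangentR_point hy h₁ h₂ h₃ hg₁ hh₂ hgh₃ (b + A₁ a)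
    have e3 := C.fundamental_point hy h₁ h₂ h₃ hg₁ hh₂ hgh₃ (b' + N a.1)
    have e4 := (congrArg (Ω.vert (Φ.act (C.point y g, C.grpPoint y.1 h))) e1).trans
      (hA₃' a (m' (b, b')))
    have e5 := (congrArg (Φ.tangentR (C.point y g) (C.grpPoint y.1 h)) (hA₁ a b)).trans e2
    have e6 := (congrArg (fun w => Φ.fundamental (Φ.act (C.point y g, C.grpPoint y.1 h))
      (𝓑.tangentL (𝓑.inv (C.grpPoint y.1 h)) (C.grpPoint y.1 h) w)) (hN a.1 b')).trans e3
    have e7 : C.pointTangent κ₃ y (g * h) (0, m' (b, b') + A₃ a) =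
        C.pointTangent κ₃ y (g * h) (0, m' (b + A₁ a, 0)) +
          C.pointTangent κ₃ y (g * h) (0, m' (0, b' + N a.1)) ↔ A₃ a = m' (A₁ a, N a.1) := by
      rw [← map_add, hb₃.1.eq_iff, Prod.mk_add_mk, add_zero, ← map_add, Prod.mk_add_mk, add_zero,
        zero_add, Prod.mk.injEq, ← Prod.mk_add_mk, map_add, add_right_inj]
      simp
    refine Iff.trans ?_ e7
    have e8 := congrArg₂ (fun u v : EuclideanSpace ℝ (Fin (m + n)) => u + v) e5 e6
    constructor
    · intro e
      exact e4.symm.trans (e.trans e8)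
    · intro e
      exact e4.trans (e.trans e8.symm)
  rw [hloc]
  constructor
  · intro e z v hzv
    obtain ⟨⟨a, b⟩, rfl⟩ := hb₁.2 z
    obtain ⟨⟨c, b'⟩, rfl⟩ := hbN.2 v
    -- Equal projections to `T(M)` mean equal base components.
    have hac : c = a.1 := by
      have e1 := C.mfderiv_proj_pointTangent hy h₁ hg₁ hP a b
      have e2 := C.mfderiv_proj_grpTangent hx h₂ hh₂ c b'
      have e3 : C.tangentM y.1 a.1 = C.tangentM y.1 c := e1.symm.trans (hzv.trans e2)
      have e4 : C.tangentM y.1 (a.1 - c) = 0 :=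
        (ContinuousLinearMap.map_sub (mfderiv 𝓘(ℝ, EuclideanSpace ℝ (Fin m)) (𝓡 m)
          C.chartM.symm y.1) a.1 c).trans (sub_eq_zero.2 e3)
      exact (sub_eq_zero.1 (C.tangentM_eq_zero hx e4)).symm
    subst hac
    exact (hterm a b b').2 (by rw [e]; rfl)
  · intro e
    refine LinearMap.ext fun a => ?_
    exact (hterm a 0 0).1 (e _ _ ((C.mfderiv_proj_pointTangent hy h₁ hg₁ hP a 0).trans
      (C.mfderiv_proj_grpTangent hx h₂ hh₂ a.1 0).symm))

end FiberedAction.Coordinates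

end Charts

/-! ### Adapted charts for submersions. -/

section Submersion

variable {m k : ℕ}

/-- A linear surjection is the first component of a linear isomorphism. -/
theorem exists_continuousLinearEquiv_fst_eq
    (r : EuclideanSpace ℝ (Fin (m + k)) →L[ℝ] EuclideanSpace ℝ (Fin m))
    (hr : Function.Surjective r) :
    ∃ e : EuclideanSpace ℝ (Fin (m + k)) ≃L[ℝ]
      EuclideanSpace ℝ (Fin m) × EuclideanSpace ℝ (Fin k), ∀ v, (e v).1 = r v := by
  let r₀ : EuclideanSpace ℝ (Fin (m + k)) →ₗ[ℝ] EuclideanSpace ℝ (Fin m) := r.toLinearMap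
  have hk : Module.finrank ℝ (LinearMap.ker r₀) = Module.finrank ℝ (EuclideanSpace ℝ (Fin k)) := by
    have h1 := r₀.finrank_range_add_finrank_ker
    rw [LinearMap.range_eq_top.2 hr, finrank_top] at h1
    simp only [finrank_euclideanSpace, Fintype.card_fin] at h1 ⊢
    omega
  let ι : LinearMap.ker r₀ ≃ₗ[ℝ] EuclideanSpace ℝ (Fin k) := LinearEquiv.ofFinrankEq _ _ hk
  obtain ⟨q, hq⟩ := (LinearMap.ker r₀).subtype.exists_leftInverse_of_injective
    (Submodule.ker_subtype _)
  have hinj : Function.Injective (r₀.prod (ι.toLinearMap ∘ₗ q)) := by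
    refine (injective_iff_map_eq_zero _).2 fun v hv => ?_
    have h1 : r₀ v = 0 := congrArg Prod.fst hv
    have h2 : ι (q v) = 0 := congrArg Prod.snd hv
    have h3 := LinearMap.congr_fun hq ⟨v, h1⟩
    have h4 : q v = ⟨v, h1⟩ := h3
    rw [h4, LinearEquiv.map_eq_zero_iff] at h2
    exact congrArg Subtype.val h2
  exact ⟨(LinearEquiv.ofInjectiveOfFinrankEq _ hinj
    (by simp [Module.finrank_prod])).toContinuousLinearEquiv, fun v => rfl⟩

/-- A submersion has adapted charts. -/
theorem exists_chart_fst_eq {S : Type*} [TopologicalSpace S]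
    [ChartedSpace (EuclideanSpace ℝ (Fin (m + k))) S] [IsManifold (𝓡 (m + k)) ∞ S]
    {ρ : S → EuclideanSpace ℝ (Fin m)} {U : Set S} (hU : IsOpen U) {s : S} (hs : s ∈ U)
    (hρ : ContMDiffOn (𝓡 (m + k)) (𝓡 m) ∞ ρ U)
    (hsurj : Function.Surjective (mfderiv (𝓡 (m + k)) (𝓡 m) ρ s)) :
    ∃ χ : OpenPartialHomeomorph S (EuclideanSpace ℝ (Fin m) × EuclideanSpace ℝ (Fin k)),
      s ∈ χ.source ∧ χ.source ⊆ U ∧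
      ContMDiffOn (𝓡 (m + k)) 𝓘(ℝ, EuclideanSpace ℝ (Fin m) × EuclideanSpace ℝ (Fin k)) ∞
        χ χ.source ∧
      ContMDiffOn 𝓘(ℝ, EuclideanSpace ℝ (Fin m) × EuclideanSpace ℝ (Fin k)) (𝓡 (m + k)) ∞
        χ.symm χ.target ∧
      ∀ t ∈ χ.source, (χ t).1 = ρ t := by
  set c := chartAt (EuclideanSpace ℝ (Fin (m + k))) s with hc
  have hcs : s ∈ c.source := mem_chart_source _ s
  have hcat : c ∈ IsManifold.maximalAtlas (𝓡 (m + k)) ∞ S := IsManifold.chart_mem_maximalAtlas s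
  set W := c.target ∩ c.symm ⁻¹' U with hW
  have hWo : IsOpen W := c.isOpen_inter_preimage_symm hU
  have hsW : c s ∈ W := ⟨c.map_source hcs, by rwa [Set.mem_preimage, c.left_inv hcs]⟩
  set r := fun u => ρ (c.symm u) with hr
  have hrW : ContDiffOn ℝ ∞ r W :=
    (hρ.comp ((contMDiffOn_symm_of_mem_maximalAtlas hcat).mono Set.inter_subset_left)
      (fun u hu => hu.2)).contDiffOn
  have hrd : ∀ u ∈ W, ContDiffAt ℝ ∞ r u := fun u hu => hrW.contDiffAt (hWo.mem_nhds hu)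
  have hrsurj : Function.Surjective (fderiv ℝ r (c s)) := by
    intro a
    obtain ⟨v, hv⟩ := hsurj a
    have h1 : MDifferentiableAt (𝓡 (m + k)) (𝓡 (m + k)) c s :=
      (contMDiffAt_of_mem_maximalAtlas hcat hcs).mdifferentiableAt (by simp)
    have h2 : HasMFDerivAt (𝓡 (m + k)) (𝓡 m) r (c s) (fderiv ℝ r (c s)) :=
      ((hrd _ hsW).differentiableAt (by simp)).hasFDerivAt.hasMFDerivAt
    have h3 : ρ =ᶠ[𝓝 s] r ∘ c := by
      filter_upwards [c.open_source.mem_nhds hcs] with t ht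
      simp only [hr, Function.comp, c.left_inv ht]
    have h4 := (h2.comp s h1.hasMFDerivAt).congr_of_eventuallyEq h3
    rw [h4.mfderiv] at hv
    exact ⟨_, hv⟩
  obtain ⟨e, he⟩ := exists_continuousLinearEquiv_fst_eq _ hrsurj
  let L : EuclideanSpace ℝ (Fin (m + k)) →L[ℝ] EuclideanSpace ℝ (Fin k) :=
    (ContinuousLinearMap.snd ℝ (EuclideanSpace ℝ (Fin m)) (EuclideanSpace ℝ (Fin k))).comp
      e.toContinuousLinearMap
  -- The submersion is completed to a local diffeomorphism by the linear map `L`, chosen so that the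
  -- derivative of `H` at `c s` is exactly `e`.
  set H := fun u => (r u, L u) with hH
  have hHd : ∀ u ∈ W, ContDiffAt ℝ ∞ H u := fun u hu => (hrd u hu).prodMk L.contDiff.contDiffAt
  have hHe : HasFDerivAt H e.toContinuousLinearMap (c s) := by
    have h1 := ((hrd _ hsW).differentiableAt (by simp)).hasFDerivAt.prodMk
      (L.hasFDerivAt (x := c s))
    refine h1.congr_fderiv (ContinuousLinearMap.ext fun v => ?_)
    exact Prod.ext (he v).symm rfl
  have hHs : HasStrictFDerivAt H e.toContinuousLinearMap (c s) :=
    (hHd _ hsW).hasStrictFDerivAt' hHe (by simp)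
  -- Smoothness of the inverse is needed on the whole target, so the source is cut down to the open
  -- set where the derivative of `H` is invertible.
  set O := W ∩ fderiv ℝ H ⁻¹' Set.range ((↑) : (EuclideanSpace ℝ (Fin (m + k)) ≃L[ℝ]
    EuclideanSpace ℝ (Fin m) × EuclideanSpace ℝ (Fin k)) → _ →L[ℝ] _) with hO
  have hOo : IsOpen O := by
    have h1 : ContDiffOn ℝ ∞ H W := fun u hu => (hHd u hu).contDiffWithinAt
    exact (h1.continuousOn_fderiv_of_isOpen hWo (by simp)).isOpen_inter_preimage hWo
      ContinuousLinearEquiv.isOpen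
  have hsO : c s ∈ O := ⟨hsW, e, hHe.fderiv.symm⟩
  let K := (hHs.toOpenPartialHomeomorph H).restrOpen O hOo
  have hKs : K.source ⊆ O := Set.inter_subset_right
  have hKsymm : ContDiffOn ℝ ∞ K.symm K.target := by
    intro z hz
    obtain ⟨hzW, e', he'⟩ := hKs (K.map_target hz)
    refine (K.contDiffAt_symm (f₀' := e') hz ?_ (hHd _ hzW)).contDiffWithinAt
    rw [he']
    exact ((hHd _ hzW).differentiableAt (by simp)).hasFDerivAt
  refine ⟨c.trans K, ?_, ?_, ?_, ?_, ?_⟩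
  · refine ⟨hcs, ?_⟩
    exact ⟨hHs.mem_toOpenPartialHomeomorph_source, hsO⟩
  · intro t ht
    have : c.symm (c t) ∈ U := (hKs ht.2).1.2
    rwa [c.left_inv ht.1] at this
  · intro t ht
    exact ((hHd _ (hKs ht.2).1).contMDiffAt.comp t
      (contMDiffAt_of_mem_maximalAtlas hcat ht.1)).contMDiffWithinAt
  · exact (contMDiffOn_symm_of_mem_maximalAtlas hcat).comp
      (hKsymm.contMDiffOn.mono Set.inter_subset_left) (fun z hz => hz.2)
  · intro t ht
    change ρ (c.symm (c t)) = ρ t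
    rw [c.left_inv ht.1]

end Submersion

/-! ### Existence of coordinates and passage from local to global. -/

section Charts

set_option linter.unusedSectionVars false

variable {m l n k : ℕ} {M 𝒢 G P : Type*}
  [TopologicalSpace M] [ChartedSpace (EuclideanSpace ℝ (Fin m)) M] [IsManifold (𝓡 m) ∞ M]
  [TopologicalSpace 𝒢] [ChartedSpace (EuclideanSpace ℝ (Fin (m + l))) 𝒢]
  [Group G] [TopologicalSpace G] [ChartedSpace (EuclideanSpace ℝ (Fin l)) G]
  [LieGroup (𝓡 l) ∞ G]
  [TopologicalSpace P] [ChartedSpace (EuclideanSpace ℝ (Fin (m + n))) P]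
  [IsManifold (𝓡 (m + l)) ∞ 𝒢] [IsManifold (𝓡 (m + n)) ∞ P]
  {π : 𝒢 → M} {𝓑 : LieGroupBundle (m := m) (l := l) G π} {πP : P → M}
  {F : Type*} [TopologicalSpace F] [ChartedSpace (EuclideanSpace ℝ (Fin n)) F]
  {Φ : FiberedAction (n := n) 𝓑 πP}
  [ChartedSpace (EuclideanSpace ℝ (Fin (m + k))) Φ.OrbitSpace]
  [IsManifold (𝓡 (m + k)) ∞ Φ.OrbitSpace]

/-- Generalized principal bundle coordinates exist around every point of the orbit space. -/
theorem FiberedAction.exists_coordinates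
    (hP : IsSmoothFiberBundle (𝓡 m) (𝓡 n) (𝓡 (m + n)) F πP)
    (hS : IsSmoothFiberBundle (𝓡 (m + k)) (𝓡 l) (𝓡 (m + n)) G Φ.toOrbit) (s : Φ.OrbitSpace) :
    ∃ C : Φ.Coordinates (k := k), s ∈ C.chartS.source := by
  obtain ⟨p, hp⟩ : ∃ p, Φ.toOrbit p = s := Quotient.exists_rep s
  have hps : Φ.orbitProj s = πP p := by rw [← hp]; rfl
  obtain ⟨τ, hxτ, hτ⟩ := 𝓑.exists_triv (πP p)
  obtain ⟨e, hse, he⟩ := hS.2 s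
  obtain ⟨eP, hpe, heP⟩ := hP.2 (πP p)
  set c := (chartAt (EuclideanSpace ℝ (Fin m)) (πP p)).restr τ.baseSet with hc
  have hcsrc : c.source = (chartAt (EuclideanSpace ℝ (Fin m)) (πP p)).source ∩ τ.baseSet := by
    rw [hc, OpenPartialHomeomorph.restr_source, τ.open_baseSet.interior_eq]
  have hcat : c ∈ IsManifold.maximalAtlas (𝓡 m) ∞ M :=
    restr_mem_maximalAtlas _ (IsManifold.chart_mem_maximalAtlas (πP p)) τ.open_baseSet
  have hpc : πP p ∈ c.source := by
    rw [hcsrc]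
    exact ⟨mem_chart_source _ _, hxτ⟩
  -- Any fixed element of `G` would do: `e` need not respect the action, and only a smooth local
  -- section is wanted.
  let σ : Φ.OrbitSpace → P := fun t => e.toOpenPartialHomeomorph.symm (t, 1)
  have hσ : ContMDiffOn (𝓡 (m + k)) (𝓡 (m + n)) ∞ σ e.baseSet :=
    he.2.comp (contMDiff_id.prodMk contMDiff_const).contMDiffOn
      (fun t ht => e.mem_target.2 ht)
  have hσo : ∀ t ∈ e.baseSet, Φ.toOrbit (σ t) = t := fun t ht => e.proj_symm_apply' ht
  have hproj : ContMDiffOn (𝓡 (m + k)) (𝓡 m) ∞ Φ.orbitProj e.baseSet := by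
    refine (hP.1.comp_contMDiffOn hσ).congr fun t ht => ?_
    conv_lhs => rw [← hσo t ht]
    rfl
  have hcont : Continuous Φ.orbitProj := Continuous.quotient_lift hP.1.continuous _
  let U := e.baseSet ∩ Φ.orbitProj ⁻¹' c.source
  have hU : IsOpen U := e.open_baseSet.inter (c.open_source.preimage hcont)
  have hsU : s ∈ U := ⟨hse, by rw [Set.mem_preimage, hps]; exact hpc⟩
  have hρ : ContMDiffOn (𝓡 (m + k)) (𝓡 m) ∞ (fun t => c (Φ.orbitProj t)) U :=
    (contMDiffOn_of_mem_maximalAtlas hcat).comp (hproj.mono Set.inter_subset_left)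
      (fun t ht => ht.2)
  have hsurj : Function.Surjective
      (mfderiv (𝓡 (m + k)) (𝓡 m) (fun t => c (Φ.orbitProj t)) s) := by
    intro a
    -- A local section of `𝒮 → M` through `s`: lift to `P` with constant fibre coordinate, then
    -- project to the orbit space. The chain rule for a right inverse gives surjectivity of the
    -- differential.
    let f : EuclideanSpace ℝ (Fin m) → Φ.OrbitSpace := fun u =>
      Φ.toOrbit (eP.toOpenPartialHomeomorph.symm (c.symm u, (eP p).2))
    have hcsymm : c.symm (c (πP p)) = πP p := c.left_inv hpc
    have hpt : eP.toOpenPartialHomeomorph.symm (πP p, (eP p).2) = p :=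
      eP.symm_apply_mk_proj (eP.mem_source.2 hpe)
    have hfs : f (c (πP p)) = s := by
      change Φ.toOrbit (eP.toOpenPartialHomeomorph.symm (c.symm (c (πP p)), (eP p).2)) = s
      rw [hcsymm, hpt, hp]
    have hf1 : MDifferentiableAt (𝓡 m) (𝓡 m) c.symm (c (πP p)) :=
      (contMDiffAt_symm_of_mem_maximalAtlas hcat (c.map_source hpc)).mdifferentiableAt (by simp)
    have hf2 : MDifferentiableAt ((𝓡 m).prod (𝓡 n)) (𝓡 (m + n)) eP.toOpenPartialHomeomorph.symm
        (c.symm (c (πP p)), (eP p).2) :=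
      (heP.2.contMDiffAt (eP.open_target.mem_nhds
        (eP.mem_target.2 (by rwa [hcsymm])))).mdifferentiableAt (by simp)
    have hf3 : MDifferentiableAt (𝓡 m) (𝓡 (m + n))
        (fun u => eP.toOpenPartialHomeomorph.symm (c.symm u, (eP p).2)) (c (πP p)) :=
      hf2.comp (f := fun u => (c.symm u, (eP p).2)) _ (hf1.prodMk mdifferentiableAt_const)
    have hf : MDifferentiableAt (𝓡 m) (𝓡 (m + k)) f (c (πP p)) :=
      (hS.1.mdifferentiable (by simp) _).comp _ hf3
    refine ⟨_, mfderiv_apply_of_comp (h := id) hfs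
      ((hρ.contMDiffAt (hU.mem_nhds hsU)).mdifferentiableAt (by simp)) hf.hasMFDerivAt
      (hasMFDerivAt_id _) ?_ a⟩
    have hev := hf1.continuousAt.eventually_mem (eP.open_baseSet.mem_nhds (by rwa [hcsymm]))
    filter_upwards [hev, c.open_target.mem_nhds (c.map_source hpc)] with u hu hut
    have : πP (eP.toOpenPartialHomeomorph.symm (c.symm u, (eP p).2)) = c.symm u :=
      eP.proj_symm_apply' hu
    change c (πP (eP.toOpenPartialHomeomorph.symm (c.symm u, (eP p).2))) = u
    rw [this, c.right_inv hut]
  obtain ⟨χ, hχs, hχU, hχ, hχsymm, hχρ⟩ := exists_chart_fst_eq hU hsU hρ hsurj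
  exact ⟨{ triv := τ
           isTriv := hτ
           chartM := c
           chartM_mem := hcat
           chartM_source := hcsrc.subset.trans Set.inter_subset_right
           chartS := χ
           chartS_smooth := hχ
           chartS_symm_smooth := hχsymm
           chartS_source := fun t ht => (hχU ht).2
           chartS_fst := hχρ
           sec := σ
           sec_smooth := hσ.mono fun t ht => (hχU ht).1
           toOrbit_sec := fun t ht => hσo t (hχU ht).1 }, hχs⟩

variable (hP : IsSmoothFiberBundle (𝓡 m) (𝓡 n) (𝓡 (m + n)) F πP) (hfree : Φ.IsFree)
  (hS : IsSmoothFiberBundle (𝓡 (m + k)) (𝓡 l) (𝓡 (m + n)) G Φ.toOrbit)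
  {Ω : Connection (𝓡 (m + k)) (𝓡 (m + n)) Φ.toOrbit} {η : Connection (𝓡 m) (𝓡 (m + l)) π}

include hP hfree hS

theorem FiberedAction.IsGeneralizedPrincipalConnection.coeffIdentities
    (hΩ : Φ.IsGeneralizedPrincipalConnection Ω η) (C : Φ.Coordinates (k := k))
    {y : EuclideanSpace ℝ (Fin m) × EuclideanSpace ℝ (Fin k)} (hy : y ∈ C.chartS.target)
    {κ₁ κ₂ κ₃ : OpenPartialHomeomorph G (EuclideanSpace ℝ (Fin l))}
    (h₁ : κ₁ ∈ IsManifold.maximalAtlas (𝓡 l) ∞ G) (h₂ : κ₂ ∈ IsManifold.maximalAtlas (𝓡 l) ∞ G)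
    (h₃ : κ₃ ∈ IsManifold.maximalAtlas (𝓡 l) ∞ G) {g h : G}
    (hg₁ : g ∈ κ₁.source) (hh₂ : h ∈ κ₂.source) (hgh₃ : g * h ∈ κ₃.source) :
    C.CoeffIdentities Ω η κ₁ κ₂ κ₃ y g h :=
  (C.coeffIdentities_iff hfree (hP.1.mdifferentiable (by simp)) hS Ω η hy h₁ h₂ h₃ hg₁ hh₂
    hgh₃).2 (hΩ _ _ ((C.proj_point hy g).trans (C.proj_grpPoint (C.fst_mem_target hy) h).symm))

theorem FiberedAction.isGeneralizedPrincipalConnection_of_coeffIdentities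
    (𝒞 : Set (Φ.Coordinates (k := k)))
    (κ : G → OpenPartialHomeomorph G (EuclideanSpace ℝ (Fin l)))
    (h𝒞 : ∀ s : Φ.OrbitSpace, ∃ C ∈ 𝒞, s ∈ C.chartS.source)
    (hκ : ∀ g : G, κ g ∈ IsManifold.maximalAtlas (𝓡 l) ∞ G ∧ g ∈ (κ g).source)
    (H : ∀ C ∈ 𝒞, ∀ y ∈ C.chartS.target, ∀ g h : G,
      C.CoeffIdentities Ω η (κ g) (κ h) (κ (g * h)) y g h) :
    Φ.IsGeneralizedPrincipalConnection Ω η := by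
  intro p γ hpγ
  obtain ⟨C, hC, hs⟩ := h𝒞 (Φ.toOrbit p)
  have hy := C.chartS.map_source hs
  obtain ⟨g, hg⟩ := C.exists_point hy (C.chartS.left_inv hs).symm
  -- Frees the coordinates `y` from `p`, so that `p` can be replaced by `C.point y g`.
  generalize C.chartS (Φ.toOrbit p) = y at hy hg
  subst hg
  obtain ⟨h, rfl⟩ := C.exists_grpPoint (C.fst_mem_target hy) (hpγ.symm.trans (C.proj_point hy g))
  exact (C.coeffIdentities_iff hfree (hP.1.mdifferentiable (by simp)) hS Ω η hy (hκ g).1 (hκ h).1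
    (hκ (g * h)).1 (hκ g).2 (hκ h).2 (hκ (g * h)).2).1 (H C hC y hy g h)

end Charts

end GenPrincipal

end

theorem theorem7p6 {m l n k : ℕ} {M 𝒢 G F P : Type*}
    [TopologicalSpace M] [T2Space M] [ChartedSpace (EuclideanSpace ℝ (Fin m)) M]
    [IsManifold (𝓡 m) ∞ M]
    [Group G] [TopologicalSpace G] [T2Space G] [ChartedSpace (EuclideanSpace ℝ (Fin l)) G]
    [LieGroup (𝓡 l) ∞ G]
    [TopologicalSpace 𝒢] [T2Space 𝒢] [ChartedSpace (EuclideanSpace ℝ (Fin (m + l))) 𝒢]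
    [IsManifold (𝓡 (m + l)) ∞ 𝒢]
    [TopologicalSpace F] [T2Space F] [ChartedSpace (EuclideanSpace ℝ (Fin n)) F]
    [IsManifold (𝓡 n) ∞ F]
    [TopologicalSpace P] [T2Space P] [ChartedSpace (EuclideanSpace ℝ (Fin (m + n))) P]
    [IsManifold (𝓡 (m + n)) ∞ P]
    -- the Lie group fiber bundle `𝒢 → M`, the fiber bundle `P → M`, the free and proper action
    {π : 𝒢 → M} (𝓑 : GenPrincipal.LieGroupBundle (m := m) (l := l) G π)
    {πP : P → M} (_hP : GenPrincipal.IsSmoothFiberBundle (𝓡 m) (𝓡 n) (𝓡 (m + n)) F πP)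
    (Φ : GenPrincipal.FiberedAction (n := n) 𝓑 πP)
    (_hfree : Φ.IsFree) (_hproper : Φ.IsProper)
    -- the smooth structure of the orbit space for which `P → P/𝒢` is a fiber bundle
    [ChartedSpace (EuclideanSpace ℝ (Fin (m + k))) Φ.OrbitSpace]
    [IsManifold (𝓡 (m + k)) ∞ Φ.OrbitSpace]
    (_hS : GenPrincipal.IsSmoothFiberBundle (𝓡 (m + k)) (𝓡 l) (𝓡 (m + n)) G Φ.toOrbit)
    -- a connection on `P → P/𝒢` and a connection on `𝒢 → M`
    (Ω : GenPrincipal.Connection (𝓡 (m + k)) (𝓡 (m + n)) Φ.toOrbit)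
    (η : GenPrincipal.Connection (𝓡 m) (𝓡 (m + l)) π) :
    -- characterization in all generalized principal bundle coordinates
    (Φ.IsGeneralizedPrincipalConnection Ω η ↔
      ∀ C : Φ.Coordinates (k := k), ∀ y ∈ C.chartS.target,
        ∀ κ₁ ∈ IsManifold.maximalAtlas (𝓡 l) ∞ G,
        ∀ κ₂ ∈ IsManifold.maximalAtlas (𝓡 l) ∞ G,
        ∀ κ₃ ∈ IsManifold.maximalAtlas (𝓡 l) ∞ G,
        ∀ g h : G, g ∈ κ₁.source → h ∈ κ₂.source → g * h ∈ κ₃.source →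
          C.CoeffIdentities Ω η κ₁ κ₂ κ₃ y g h) ∧
    -- it is enough to have the identities in a family of coordinates covering `P/𝒢` and `G`
    (∀ (𝒞 : Set (Φ.Coordinates (k := k)))
        (κ : G → OpenPartialHomeomorph G (EuclideanSpace ℝ (Fin l))),
      (∀ s : Φ.OrbitSpace, ∃ C ∈ 𝒞, s ∈ C.chartS.source) →
      (∀ g : G, κ g ∈ IsManifold.maximalAtlas (𝓡 l) ∞ G ∧ g ∈ (κ g).source) →
      (Φ.IsGeneralizedPrincipalConnection Ω η ↔
        ∀ C ∈ 𝒞, ∀ y ∈ C.chartS.target, ∀ g h : G,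
          C.CoeffIdentities Ω η (κ g) (κ h) (κ (g * h)) y g h)) := by

  refine ⟨⟨fun hΩ C y hy κ₁ h₁ κ₂ h₂ κ₃ h₃ g h hg hh hgh =>
      hΩ.coeffIdentities _hP _hfree _hS C hy h₁ h₂ h₃ hg hh hgh, fun H => ?_⟩,
    fun 𝒞 κ h𝒞 hκ => ⟨fun hΩ C _ y hy g h => hΩ.coeffIdentities _hP _hfree _hS C hy
      (hκ g).1 (hκ h).1 (hκ (g * h)).1 (hκ g).2 (hκ h).2 (hκ (g * h)).2,
      fun H => Φ.isGeneralizedPrincipalConnection_of_coeffIdentities _hP _hfree _hS 𝒞 κ h𝒞 hκ H⟩⟩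
  -- The first converse is the covering criterion for the family of all coordinates, with the
  -- preferred chart at each element of `G`; `exists_coordinates` supplies the covering.
  refine Φ.isGeneralizedPrincipalConnection_of_coeffIdentities _hP _hfree _hS Set.univ
    (fun g => chartAt (EuclideanSpace ℝ (Fin l)) g) (fun s => ?_)
    (fun g => ⟨IsManifold.chart_mem_maximalAtlas g, mem_chart_source _ g⟩)
    (fun C _ y hy g h => H C y hy _ (IsManifold.chart_mem_maximalAtlas g) _
      (IsManifold.chart_mem_maximalAtlas h) _ (IsManifold.chart_mem_maximalAtlas (g * h)) g h
      (mem_chart_source _ g) (mem_chart_source _ h) (mem_chart_source _ (g * h)))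
  obtain ⟨C, hC⟩ := Φ.exists_coordinates _hP _hS s
  exact ⟨C, trivial, hC⟩
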